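/- Let $R$ be a commutative ring with identity and let $A$ be a positively graded commutative DG $R$-algebra, i.e. an $R$-complex $A$, indexed homologically, with $A_i=0$ for $i<0$ and with a chain map $A\otimes_R A\to A$ that is associative, unital and graded commutative. A DG $A$-module is an $R$-complex $M$ with an associative and unital chain map $A\otimes_R M\to M$; morphisms of DG $A$-modules are the $A$-linear chain maps, and with them DG $A$-modules form an abelian category with enough projectives. For DG $A$-modules $M,N$ and $i\ge 0$ let $\operatorname{YExt}^i_A(M,N)$ be the $i$-th Ext group in this abelian category: the $i$-th cohomology of the complex of groups of morphisms from $L_\bullet$ to $N$, where $\cdots\to L_1\to L_0\to M\to 0$ is a resolution of $M$ by projective objects of the category. Let $\operatorname{Hom}_A(M,N)$ be the $R$-complex whose elements of degree $n$ are the families $f$ of $R$-linear maps $M_j\to N_{j+n}$ ($j\in\mathbb{Z}$) with $f(am)=(-1)^{n|a|}af(m)$, with differential $\partial(f)=\partial^N f-(-1)^n f\partial^M$. A DG $A$-module $P$ is semi-projective if $\operatorname{Hom}_A(P,-)$ preserves surjective morphisms and quasiisomorphisms. Set $\operatorname{Ext}^i_A(M,N)=\operatorname{H}_{-i}(\operatorname{RHom}_A(M,N))=\operatorname{H}_{-i}(\operatorname{Hom}_A(P,N))$,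 where $P\to M$ is a quasiisomorphism from a semi-projective DG $A$-module $P$. Let $N$ and $Q$ be DG $A$-modules such that $Q$ is semi-projective. Then for every $i\geq 1$ there is an isomorphism of abelian groups $$\operatorname{YExt}^i_A(Q,N)\cong\operatorname{Ext}^i_A(Q,N),$$ where the right-hand side may be computed with any semi-projective resolution $P\to Q$ (for instance $P=Q$). -/

import Mathlib

open CategoryTheory CategoryTheory.Limits

universe u

/-- A positively graded commutative differential graded `R`-algebra: an `R`-complex
(homologically indexed by `ℤ`) with an `R`-bilinear product which is a chain map
`A ⊗ A ⟶ A` (the Leibniz rule), associative, unital and graded commutative, and such that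
`A_i = 0` for `i < 0`.  The product of elements of degrees `i` and `j` is recorded in every
degree `k` that is equal to `i + j`. -/
structure DGAlgebra (R : Type u) [CommRing R] where
  /-- the underlying `R`-complex -/
  cx : ChainComplex (ModuleCat.{u} R) ℤ
  /-- the product -/
  mul : ∀ {i j k : ℤ}, i + j = k → (cx.X i →ₗ[R] cx.X j →ₗ[R] cx.X k)
  /-- the unit -/
  one : cx.X 0
  one_mul : ∀ {i : ℤ} (h : 0 + i = i) (a : cx.X i), mul h one a = a
  mul_one : ∀ {i : ℤ} (h : i + 0 = i) (a : cx.X i), mul h a one = a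
  mul_assoc : ∀ {i j k ij jk l : ℤ} (hij : i + j = ij) (hjk : j + k = jk)
    (h : ij + k = l) (h' : i + jk = l) (a : cx.X i) (b : cx.X j) (c : cx.X k),
    mul h (mul hij a b) c = mul h' a (mul hjk b c)
  mul_comm : ∀ {i j k : ℤ} (h : i + j = k) (h' : j + i = k) (a : cx.X i) (b : cx.X j),
    mul h a b = (i * j).negOnePow • mul h' b a
  leibniz : ∀ {i i' j j' k k' : ℤ}, i' + 1 = i → j' + 1 = j → k' + 1 = k →
    ∀ (h : i + j = k) (h₁ : i' + j = k') (h₂ : i + j' = k') (a : cx.X i) (b : cx.X j),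
    (cx.d k k').hom (mul h a b) =
      mul h₁ ((cx.d i i').hom a) b + i.negOnePow • mul h₂ a ((cx.d j j').hom b)
  eq_zero_of_neg : ∀ (i : ℤ), i < 0 → ∀ a : cx.X i, a = 0

/-- A differential graded module over `A`: an `R`-complex with an `R`-bilinear scalar
multiplication which is a chain map `A ⊗ M ⟶ M`, associative and unital. -/
structure DGModule {R : Type u} [CommRing R] (A : DGAlgebra R) where
  /-- the underlying `R`-complex -/
  cx : ChainComplex (ModuleCat.{u} R) ℤ
  /-- the scalar multiplication -/
  smul : ∀ {i j k : ℤ}, i + j = k → (A.cx.X i →ₗ[R] cx.X j →ₗ[R] cx.X k)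
  one_smul : ∀ {i : ℤ} (h : 0 + i = i) (m : cx.X i), smul h A.one m = m
  mul_smul : ∀ {i j k ij jk l : ℤ} (hij : i + j = ij) (hjk : j + k = jk)
    (h : ij + k = l) (h' : i + jk = l) (a : A.cx.X i) (b : A.cx.X j) (m : cx.X k),
    smul h (A.mul hij a b) m = smul h' a (smul hjk b m)
  leibniz : ∀ {i i' j j' k k' : ℤ}, i' + 1 = i → j' + 1 = j → k' + 1 = k →
    ∀ (h : i + j = k) (h₁ : i' + j = k') (h₂ : i + j' = k') (a : A.cx.X i) (m : cx.X j),
    (cx.d k k').hom (smul h a m) =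
      smul h₁ ((A.cx.d i i').hom a) m + i.negOnePow • smul h₂ a ((cx.d j j').hom m)

namespace DGModule

variable {R : Type u} [CommRing R] {A : DGAlgebra R}

/-- A morphism of DG modules: an `A`-linear chain map. -/
@[ext]
structure Hom (M N : DGModule A) where
  /-- the underlying chain map -/
  hom : M.cx ⟶ N.cx
  map_smul : ∀ {i j k : ℤ} (h : i + j = k) (a : A.cx.X i) (m : M.cx.X j),
    (hom.f k).hom (M.smul h a m) = N.smul h a ((hom.f j).hom m)

/-- The category of DG `A`-modules. -/
instance category : Category.{u} (DGModule A) where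
  Hom M N := Hom M N
  id M := ⟨𝟙 M.cx, by intros; simp⟩
  comp f g := ⟨f.hom ≫ g.hom, by intros; simp [f.map_smul, g.map_smul]⟩

/-- The component in degree `i` of a morphism of DG modules. -/
def Hom.app {M N : DGModule A} (f : M ⟶ N) (i : ℤ) : M.cx.X i →ₗ[R] N.cx.X i :=
  (Hom.hom f |>.f i).hom

theorem app_smul {M N : DGModule A} (f : M ⟶ N) {i j k : ℤ} (h : i + j = k) (a : A.cx.X i)
    (m : M.cx.X j) : Hom.app f k (M.smul h a m) = N.smul h a (Hom.app f j m) :=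
  Hom.map_smul f h a m

theorem app_d {M N : DGModule A} (f : M ⟶ N) (i j : ℤ) (m : M.cx.X i) :
    Hom.app f j ((M.cx.d i j).hom m) = (N.cx.d i j).hom (Hom.app f i m) := by
  have := (Hom.hom f).comm i j
  exact (congrArg (fun g => g.hom m) this).symm

theorem hom_ext' {M N : DGModule A} {f g : M ⟶ N}
    (h : ∀ i m, Hom.app f i m = Hom.app g i m) : f = g := by
  apply Hom.ext
  ext i m
  exact h i m

@[simp]
theorem comp_app {M N P : DGModule A} (f : M ⟶ N) (g : N ⟶ P) (i : ℤ) (m : M.cx.X i) :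
    Hom.app (f ≫ g) i m = Hom.app g i (Hom.app f i m) := rfl

@[simp]
theorem id_app {M : DGModule A} (i : ℤ) (m : M.cx.X i) :
    Hom.app (𝟙 M) i m = m := rfl

/-- A morphism given by its components. -/
def mkHom {M N : DGModule A} (φ : ∀ i, M.cx.X i →ₗ[R] N.cx.X i)
    (hd : ∀ i j, j + 1 = i → ∀ m, φ j ((M.cx.d i j).hom m) = (N.cx.d i j).hom (φ i m))
    (hs : ∀ {i j k : ℤ} (h : i + j = k) (a : A.cx.X i) (m : M.cx.X j),
      φ k (M.smul h a m) = N.smul h a (φ j m)) : M ⟶ N where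
  hom :=
    { f := fun i => ModuleCat.ofHom (φ i)
      comm' := by
        intro i j hij
        ext m
        exact (hd i j hij m).symm }
  map_smul := hs

@[simp]
theorem mkHom_app {M N : DGModule A} (φ : ∀ i, M.cx.X i →ₗ[R] N.cx.X i) (hd) (hs) (i : ℤ)
    (m : M.cx.X i) : Hom.app (mkHom (M := M) (N := N) φ hd hs) i m = φ i m := rfl

section Preadditive

variable (M N : DGModule A)

instance : Zero (M ⟶ N) := ⟨⟨0, by intros; simp⟩⟩
instance : Add (M ⟶ N) :=
  ⟨fun f g => ⟨Hom.hom f + Hom.hom g, by intros; simp [Hom.map_smul]⟩⟩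
instance : Neg (M ⟶ N) := ⟨fun f => ⟨-Hom.hom f, by intros; simp [Hom.map_smul]⟩⟩
instance : Sub (M ⟶ N) :=
  ⟨fun f g => ⟨Hom.hom f - Hom.hom g, by intros; simp [Hom.map_smul]⟩⟩
instance : SMul ℕ (M ⟶ N) :=
  ⟨fun n f => ⟨n • Hom.hom f, by intros; simp [Hom.map_smul]⟩⟩
instance : SMul ℤ (M ⟶ N) :=
  ⟨fun n f => ⟨n • Hom.hom f, by intros; simp [Hom.map_smul]⟩⟩

instance : AddCommGroup (M ⟶ N) :=
  Function.Injective.addCommGroup (fun f : M ⟶ N => Hom.hom f)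
    (fun _ _ h => Hom.ext h) rfl (fun _ _ => rfl) (fun _ => rfl) (fun _ _ => rfl)
    (fun _ _ => rfl) (fun _ _ => rfl)

instance preadditive : Preadditive (DGModule A) where
  add_comp _ _ _ f g h := by
    apply hom_ext'; intro i m
    exact map_add (Hom.app h i) _ _
  comp_add _ _ _ f g h := rfl

end Preadditive

@[simp]
theorem zero_app {M N : DGModule A} (i : ℤ) (m : M.cx.X i) :
    Hom.app (0 : M ⟶ N) i m = 0 := rfl

section Constructions

/-- The DG module with given components, differential and scalar multiplication. -/
def ofData (X : ℤ → Type u) [∀ i, AddCommGroup (X i)] [∀ i, Module R (X i)]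
    (d : ∀ i j, X i →ₗ[R] X j) (shape : ∀ i j, j + 1 ≠ i → d i j = 0)
    (d_d : ∀ i j k, j + 1 = i → k + 1 = j → ∀ x, d j k (d i j x) = 0)
    (smul : ∀ {i j k : ℤ}, i + j = k → (A.cx.X i →ₗ[R] X j →ₗ[R] X k))
    (one_smul : ∀ {i : ℤ} (h : 0 + i = i) (m : X i), smul h A.one m = m)
    (mul_smul : ∀ {i j k ij jk l : ℤ} (hij : i + j = ij) (hjk : j + k = jk)
      (h : ij + k = l) (h' : i + jk = l) (a : A.cx.X i) (b : A.cx.X j) (m : X k),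
      smul h (A.mul hij a b) m = smul h' a (smul hjk b m))
    (leibniz : ∀ {i i' j j' k k' : ℤ}, i' + 1 = i → j' + 1 = j → k' + 1 = k →
      ∀ (h : i + j = k) (h₁ : i' + j = k') (h₂ : i + j' = k') (a : A.cx.X i) (m : X j),
      d k k' (smul h a m) =
        smul h₁ ((A.cx.d i i').hom a) m + i.negOnePow • smul h₂ a (d j j' m)) :
    DGModule A where
  cx :=
    { X := fun i => ModuleCat.of R (X i)
      d := fun i j => ModuleCat.ofHom (d i j)
      shape := by
        intro i j h
        rw [shape i j h]; rfl
      d_comp_d' := by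
        intro i j k h h'
        ext x
        exact d_d i j k h h' x }
  smul := smul
  one_smul := one_smul
  mul_smul := mul_smul
  leibniz := leibniz

theorem d_d_apply (C : ChainComplex (ModuleCat.{u} R) ℤ) (i j k : ℤ) (x : C.X i) :
    (C.d j k).hom ((C.d i j).hom x) = 0 :=
  congrArg (fun g => g.hom x) (C.d_comp_d i j k)

theorem d_eq_zero (C : ChainComplex (ModuleCat.{u} R) ℤ) (i j : ℤ) (h : j + 1 ≠ i) :
    (C.d i j).hom = 0 :=
  congrArg (fun g => g.hom) (C.shape i j h)

variable (M : DGModule A) (S : ∀ i, Submodule R (M.cx.X i))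
  (hd : ∀ i j, ∀ m ∈ S i, (M.cx.d i j).hom m ∈ S j)
  (hs : ∀ {i j k : ℤ} (h : i + j = k) (a : A.cx.X i), ∀ m ∈ S j, M.smul h a m ∈ S k)

/-- A DG submodule. -/
def sub : DGModule A :=
  ofData (fun i => S i)
    (fun i j => (M.cx.d i j).hom.restrict (hd i j))
    (by
      intro i j h
      ext x
      simp [d_eq_zero _ _ _ h])
    (by
      intro i j k _ _ x
      ext
      simp [d_d_apply])
    (fun {i j k} h => LinearMap.mk₂ R (fun a m => ⟨M.smul h a m.1, hs h a m.1 m.2⟩)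
      (by intros; ext; simp) (by intros; ext; simp) (by intros; ext; simp)
      (by intros; ext; simp))
    (by intro i h m; ext; simp [M.one_smul])
    (by intro i j k ij jk l hij hjk h h' a b m; ext; simp [M.mul_smul hij hjk h h'])
    (by
      intro i i' j j' k k' hi hj hk h h₁ h₂ a m
      ext
      have := M.leibniz hi hj hk h h₁ h₂ a m.1
      simpa [Units.smul_def] using this)

/-- The quotient by a DG submodule. -/
def quot : DGModule A :=
  ofData (fun i => M.cx.X i ⧸ S i)
    (fun i j => (S i).mapQ (S j) (M.cx.d i j).hom (hd i j))
    (by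
      intro i j h
      ext x
      simp [d_eq_zero _ _ _ h])
    (by
      intro i j k _ _ x
      obtain ⟨x, rfl⟩ := Submodule.Quotient.mk_surjective _ x
      simp [d_d_apply])
    (fun {i j k} h => LinearMap.mk₂ R (fun a m => (S j).mapQ (S k) (M.smul h a) (hs h a) m)
      (by
        intro a b m
        obtain ⟨m, rfl⟩ := Submodule.Quotient.mk_surjective _ m
        simp)
      (by
        intro r a m
        obtain ⟨m, rfl⟩ := Submodule.Quotient.mk_surjective _ m
        simp)
      (by intros; simp) (by intros; simp))
    (by
      intro i h m
      obtain ⟨m, rfl⟩ := Submodule.Quotient.mk_surjective _ m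
      simp [M.one_smul])
    (by
      intro i j k ij jk l hij hjk h h' a b m
      obtain ⟨m, rfl⟩ := Submodule.Quotient.mk_surjective _ m
      simp [M.mul_smul hij hjk h h'])
    (by
      intro i i' j j' k k' hi hj hk h h₁ h₂ a m
      obtain ⟨m, rfl⟩ := Submodule.Quotient.mk_surjective _ m
      have := congrArg (Submodule.Quotient.mk (p := S k')) (M.leibniz hi hj hk h h₁ h₂ a m)
      simpa [Units.smul_def] using this)

end Constructions

section Lifting

theorem exists_lift {M N W : DGModule A} (f : M ⟶ N) (hf : ∀ i, Function.Injective (Hom.app f i))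
    (k : W ⟶ N) (hk : ∀ i x, ∃ y, Hom.app f i y = Hom.app k i x) : ∃ l : W ⟶ M, l ≫ f = k := by
  choose l hl using hk
  refine ⟨mkHom (fun i => ⟨⟨l i, ?_⟩, ?_⟩) ?_ ?_, ?_⟩
  · intro x y; apply hf; simp [hl]
  · intro r x; apply hf; simp [hl]
  · intro i j _ m
    apply hf j
    simp [app_d, hl]
  · intro i j k' h a m
    apply hf
    simp [app_smul, hl]
  · apply hom_ext'; intro i m
    simp [hl]

theorem exists_desc {M N W : DGModule A} (f : M ⟶ N) (hf : ∀ i, Function.Surjective (Hom.app f i))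
    (k : M ⟶ W) (hk : ∀ i x, Hom.app f i x = 0 → Hom.app k i x = 0) :
    ∃ l : N ⟶ W, f ≫ l = k := by
  have hk' : ∀ i x y, Hom.app f i x = Hom.app f i y → Hom.app k i x = Hom.app k i y := by
    intro i x y h
    have := hk i (x - y) (by simp [h])
    simpa [sub_eq_zero] using this
  choose s hs using hf
  have key : ∀ i x, Hom.app k i (s i (Hom.app f i x)) = Hom.app k i x :=
    fun i x => hk' i _ _ (hs i _)
  refine ⟨mkHom (fun i => ⟨⟨fun x => Hom.app k i (s i x), ?_⟩, ?_⟩) ?_ ?_, ?_⟩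
  · intro x y
    rw [← map_add]; apply hk'; simp [hs]
  · intro r x
    simp only [RingHom.id_apply]
    rw [← map_smul]; apply hk'; simp [hs]
  · intro i j _ m
    change Hom.app k j _ = (W.cx.d i j).hom (Hom.app k i _)
    rw [← app_d]; apply hk'; simp [app_d, hs]
  · intro i j k' h a m
    change Hom.app k k' _ = W.smul h a (Hom.app k j _)
    rw [← app_smul]; apply hk'; simp [app_smul, hs]
  · apply hom_ext'; intro i m
    exact key i m

/-- The kernel of a morphism. -/
def ker {M N : DGModule A} (f : M ⟶ N) : DGModule A :=
  sub M (fun i => LinearMap.ker (Hom.app f i))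
    (by intro i j m hm; simp_all [app_d]) (by intro i j k h a m hm; simp_all [app_smul])

/-- The inclusion of the kernel. -/
def kerι {M N : DGModule A} (f : M ⟶ N) : ker f ⟶ M :=
  mkHom (M := ker f) (fun i => (LinearMap.ker (Hom.app f i)).subtype)
    (fun _ _ _ _ => rfl) (fun _ _ _ => rfl)

theorem kerι_app {M N : DGModule A} (f : M ⟶ N) (i : ℤ) (x : LinearMap.ker (Hom.app f i)) :
    Hom.app (kerι f) i x = x.1 := rfl

/-- The cokernel of a morphism. -/
def coker {M N : DGModule A} (f : M ⟶ N) : DGModule A :=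
  quot N (fun i => LinearMap.range (Hom.app f i))
    (by rintro i j _ ⟨m, rfl⟩; exact ⟨_, app_d f i j m⟩)
    (by rintro i j k h a _ ⟨m, rfl⟩; exact ⟨_, app_smul f h a m⟩)

/-- The projection to the cokernel. -/
def cokerπ {M N : DGModule A} (f : M ⟶ N) : N ⟶ coker f :=
  mkHom (N := coker f) (fun i => (LinearMap.range (Hom.app f i)).mkQ)
    (fun _ _ _ _ => rfl) (fun _ _ _ => rfl)

theorem kerι_injective {M N : DGModule A} (f : M ⟶ N) (i : ℤ) :
    Function.Injective (Hom.app (kerι f) i) :=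
  (LinearMap.ker (Hom.app f i)).subtype_injective

theorem kerι_comp {M N : DGModule A} (f : M ⟶ N) : kerι f ≫ f = 0 := by
  apply hom_ext'; intro i (m : LinearMap.ker (Hom.app f i))
  exact m.2

theorem cokerπ_surjective {M N : DGModule A} (f : M ⟶ N) (i : ℤ) :
    Function.Surjective (Hom.app (cokerπ f) i) :=
  (LinearMap.range (Hom.app f i)).mkQ_surjective

theorem cokerπ_eq_zero {M N : DGModule A} (f : M ⟶ N) (i : ℤ) (x : N.cx.X i) :
    Hom.app (cokerπ f) i x = 0 ↔ ∃ y, Hom.app f i y = x :=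
  Submodule.Quotient.mk_eq_zero (LinearMap.range (Hom.app f i))

theorem comp_cokerπ {M N : DGModule A} (f : M ⟶ N) : f ≫ cokerπ f = 0 := by
  apply hom_ext'; intro i m
  exact (cokerπ_eq_zero f i _).2 ⟨m, rfl⟩

theorem mono_of_injective {M N : DGModule A} (f : M ⟶ N)
    (hf : ∀ i, Function.Injective (Hom.app f i)) : Mono f := by
  constructor
  intro W g h e
  apply hom_ext'; intro i m
  apply hf i
  rw [← comp_app, ← comp_app, e]

theorem epi_of_surjective {M N : DGModule A} (f : M ⟶ N)
    (hf : ∀ i, Function.Surjective (Hom.app f i)) : Epi f := by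
  constructor
  intro W g h e
  apply hom_ext'; intro i n
  obtain ⟨m, rfl⟩ := hf i n
  rw [← comp_app, ← comp_app, e]

theorem injective_of_mono {M N : DGModule A} (f : M ⟶ N) [Mono f] (i : ℤ) :
    Function.Injective (Hom.app f i) := by
  rw [injective_iff_map_eq_zero]
  intro m hm
  have : kerι f = 0 := by
    rw [← cancel_mono f, kerι_comp, zero_comp]
  have h2 := kerι_app f i ⟨m, hm⟩
  rw [this] at h2
  exact h2.symm

theorem surjective_of_epi {M N : DGModule A} (f : M ⟶ N) [Epi f] (i : ℤ) :
    Function.Surjective (Hom.app f i) := by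
  intro n
  have : cokerπ f = 0 := by
    rw [← cancel_epi f, comp_cokerπ, comp_zero]
  exact (cokerπ_eq_zero f i n).1 (by rw [this]; rfl)

/-- An injective morphism `f` whose image is the kernel of `g` is a kernel of `g`. -/
noncomputable def isKernel {M N P : DGModule A} (f : M ⟶ N) (g : N ⟶ P) (w : f ≫ g = 0)
    (hf : ∀ i, Function.Injective (Hom.app f i))
    (hg : ∀ i x, Hom.app g i x = 0 → ∃ y, Hom.app f i y = x) :
    IsLimit (KernelFork.ofι f w) :=
  haveI := mono_of_injective f hf
  have H : ∀ {W : DGModule A} (k : W ⟶ N), k ≫ g = 0 → ∃ l : W ⟶ M, l ≫ f = k :=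
    fun k hk => exists_lift f hf k fun i x => hg i _ (by rw [← comp_app, hk]; rfl)
  KernelFork.IsLimit.ofι f w (fun k hk => (H k hk).choose) (fun k hk => (H k hk).choose_spec)
    (fun k hk m hm => by rw [← cancel_mono f, hm, (H k hk).choose_spec])

/-- A surjective morphism `g` whose kernel is the image of `f` is a cokernel of `f`. -/
noncomputable def isCokernel {M N P : DGModule A} (f : M ⟶ N) (g : N ⟶ P) (w : f ≫ g = 0)
    (hg : ∀ i, Function.Surjective (Hom.app g i))
    (hf : ∀ i x, Hom.app g i x = 0 → ∃ y, Hom.app f i y = x) :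
    IsColimit (CokernelCofork.ofπ g w) :=
  haveI := epi_of_surjective g hg
  have H : ∀ {W : DGModule A} (k : N ⟶ W), f ≫ k = 0 → ∃ l : P ⟶ W, g ≫ l = k :=
    fun k hk => exists_desc g hg k fun i x hx => by
      obtain ⟨y, rfl⟩ := hf i x hx
      rw [← comp_app, hk]; rfl
  CokernelCofork.IsColimit.ofπ g w (fun k hk => (H k hk).choose)
    (fun k hk => (H k hk).choose_spec)
    (fun k hk m hm => by rw [← cancel_epi g, hm, (H k hk).choose_spec])

end Lifting

section DirectSum

open Classical in
/-- The direct sum of a family of DG modules. -/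
noncomputable def dsum {J : Type u} (M : J → DGModule A) : DGModule A :=
  ofData (fun i => Π₀ j, (M j).cx.X i)
    (fun i k => DFinsupp.mapRange.linearMap fun j => ((M j).cx.d i k).hom)
    (by
      intro i k h
      ext j x j'
      simp [d_eq_zero _ _ _ h])
    (by
      intro i j k _ _ x
      ext j'
      simp [d_d_apply])
    (fun {i j k} h => LinearMap.mk₂ R
      (fun a x => DFinsupp.mapRange.linearMap (fun j => (M j).smul h a) x)
      (by intros; ext; simp) (by intros; ext; simp) (by intros; ext; simp)
      (by intros; ext; simp))
    (by intro i h m; ext j; simp [(M j).one_smul])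
    (by intro i j k ij jk l hij hjk h h' a b m; ext s; simp [(M s).mul_smul hij hjk h h'])
    (by
      intro i i' j j' k k' hi hj hk h h₁ h₂ a m
      ext s
      have := (M s).leibniz hi hj hk h h₁ h₂ a (m s)
      simpa [Units.smul_def] using this)

open Classical in
/-- The inclusion of a direct summand. -/
noncomputable def dsumι {J : Type u} (M : J → DGModule A) (j : J) : M j ⟶ dsum M :=
  mkHom (N := dsum M) (fun i => DFinsupp.lsingle (M := fun j => (M j).cx.X i) j)
    (by
      intro i k _ m
      exact (DFinsupp.mapRange_single (β₁ := fun j => (M j).cx.X i)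
        (β₂ := fun j => (M j).cx.X k) (f := fun j x => ((M j).cx.d i k).hom x)
        (hf := fun j => map_zero ((M j).cx.d i k).hom) (i := j) (b := m)).symm)
    (by
      intro i j' k h a m
      exact (DFinsupp.mapRange_single (β₁ := fun j => (M j).cx.X j')
        (β₂ := fun j => (M j).cx.X k) (f := fun j x => (M j).smul h a x)
        (hf := fun j => map_zero ((M j).smul h a)) (i := j) (b := m)).symm)

theorem dsum_hom_ext {J : Type u} (M : J → DGModule A) {W : DGModule A} {f g : dsum M ⟶ W}
    (h : ∀ j, dsumι M j ≫ f = dsumι M j ≫ g) : f = g := by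
  classical
  apply hom_ext'
  intro i
  let f' : (Π₀ j, (M j).cx.X i) →ₗ[R] W.cx.X i := Hom.app f i
  let g' : (Π₀ j, (M j).cx.X i) →ₗ[R] W.cx.X i := Hom.app g i
  have : f' = g' := by
    refine DFinsupp.lhom_ext fun j x => ?_
    exact congrArg (fun φ => Hom.app φ i x) (h j)
  intro m
  exact congrArg (fun φ => φ m) this

open Classical in
/-- The morphism from a direct sum given by morphisms from the summands. -/
noncomputable def dsumDesc {J : Type u} (M : J → DGModule A) {W : DGModule A}
    (f : ∀ j, M j ⟶ W) : dsum M ⟶ W :=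
  mkHom (M := dsum M) (fun i => DFinsupp.lsum ℕ fun j => Hom.app (f j) i)
    (by
      intro i k _
      suffices H : (DFinsupp.lsum ℕ fun j => Hom.app (f j) k) ∘ₗ
          (DFinsupp.mapRange.linearMap fun j => ((M j).cx.d i k).hom) =
          (W.cx.d i k).hom ∘ₗ (DFinsupp.lsum ℕ fun j => Hom.app (f j) i) from
        fun m => congrArg (fun φ => φ m) H
      ext j x
      simp [app_d])
    (by
      intro i j' k h a
      suffices H : (DFinsupp.lsum ℕ fun j => Hom.app (f j) k) ∘ₗ
          (DFinsupp.mapRange.linearMap fun j => (M j).smul h a) =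
          (W.smul h a) ∘ₗ (DFinsupp.lsum ℕ fun j => Hom.app (f j) j') from
        fun m => congrArg (fun φ => φ m) H
      ext j x
      simp [app_smul])

theorem dsumι_desc {J : Type u} (M : J → DGModule A) {W : DGModule A}
    (f : ∀ j, M j ⟶ W) (j : J) : dsumι M j ≫ dsumDesc M f = f j := by
  classical
  apply hom_ext'; intro i m
  exact DFinsupp.lsum_single ℕ (fun j => Hom.app (f j) i) j m

/-- The direct sum is the coproduct. -/
noncomputable def dsumIsColimit {J : Type u} (M : J → DGModule A) :
    IsColimit (Cofan.mk (dsum M) (dsumι M)) :=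
  Cofan.IsColimit.mk _ (fun s => dsumDesc M s.inj) (fun s j => dsumι_desc M _ j)
    (fun s m hm => dsum_hom_ext M fun j => by rw [dsumι_desc]; exact hm j)

instance hasCoproducts : HasCoproducts.{u} (DGModule A) := fun J =>
  ⟨fun F => by
    have : HasColimit (Discrete.functor (F.obj ∘ Discrete.mk)) :=
      ⟨⟨⟨_, dsumIsColimit fun j => F.obj ⟨j⟩⟩⟩⟩
    exact hasColimit_of_iso Discrete.natIsoFunctor⟩

end DirectSum

/-- The category of DG `A`-modules is abelian. -/
noncomputable instance abelian : Abelian (DGModule A) where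
  has_finite_products := by
    have := hasFiniteCoproducts_of_hasCoproducts.{u} (DGModule A)
    have := HasFiniteBiproducts.of_hasFiniteCoproducts (C := DGModule A)
    infer_instance
  has_kernels := ⟨fun f => ⟨⟨⟨_, isKernel (kerι f) f (kerι_comp f) (kerι_injective f)
    fun _ x hx => ⟨(⟨x, hx⟩ : LinearMap.ker (Hom.app f _)), rfl⟩⟩⟩⟩⟩
  has_cokernels := ⟨fun f => ⟨⟨⟨_, isCokernel f (cokerπ f) (comp_cokerπ f) (cokerπ_surjective f)
    fun i x hx => (cokerπ_eq_zero f i x).1 hx⟩⟩⟩⟩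
  normalMonoOfMono f _ := ⟨⟨coker f, cokerπ f, comp_cokerπ f,
    isKernel f (cokerπ f) (comp_cokerπ f) (injective_of_mono f)
      fun i x hx => (cokerπ_eq_zero f i x).1 hx⟩⟩
  normalEpiOfEpi f _ := ⟨⟨ker f, kerι f, kerι_comp f,
    isCokernel (kerι f) f (kerι_comp f) (surjective_of_epi f) fun _ x hx => ⟨(⟨x, hx⟩ : LinearMap.ker (Hom.app f _)), rfl⟩⟩⟩

section Disk

/-- The identification of components of equal degree (and zero in unequal degrees). -/
def tr (C : ChainComplex (ModuleCat.{u} R) ℤ) (i j : ℤ) : C.X i →ₗ[R] C.X j :=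
  if h : i = j then h ▸ LinearMap.id else 0

@[simp]
theorem tr_self (C : ChainComplex (ModuleCat.{u} R) ℤ) (i : ℤ) : tr C i i = LinearMap.id := by
  simp [tr]

theorem tr_d (C : ChainComplex (ModuleCat.{u} R) ℤ) {i j k : ℤ} (h : j = k) (x : C.X i) :
    tr C j k ((C.d i j).hom x) = (C.d i k).hom x := by
  subst h; simp

theorem d_tr (C : ChainComplex (ModuleCat.{u} R) ℤ) {i j k : ℤ} (h : i = j) (x : C.X i) :
    (C.d j k).hom (tr C i j x) = (C.d i k).hom x := by
  subst h; simp

theorem tr_mul {i j k j' k' : ℤ} (h : i + j = k) (h' : i + j' = k') (hj : j = j')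
    (a : A.cx.X i) (b : A.cx.X j) :
    tr A.cx k k' (A.mul h a b) = A.mul h' a (tr A.cx j j' b) := by
  subst hj; subst h; subst h'; simp

theorem tr_smul (M : DGModule A) {i j k i' : ℤ} (h : i + j = k) (h' : i' + j = k) (hi : i = i')
    (a : A.cx.X i) (m : M.cx.X j) : M.smul h' (tr A.cx i i' a) m = M.smul h a m := by
  subst hi; simp

theorem tr_tr (C : ChainComplex (ModuleCat.{u} R) ℤ) {i j k : ℤ} (h : i = j) (h' : j = k)
    (x : C.X i) : tr C j k (tr C i j x) = tr C i k x := by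
  subst h; subst h'; simp

theorem mul_tr_one {i j : ℤ} (hj : 0 = j) (h : i + j = i) (a : A.cx.X i) :
    A.mul h a (tr A.cx 0 j A.one) = a := by
  subst hj; simp [A.mul_one]

theorem tr_one_smul (M : DGModule A) {i j : ℤ} (hj : 0 = j) (h : j + i = i) (m : M.cx.X i) :
    M.smul h (tr A.cx 0 j A.one) m = m := by
  subst hj; simp [M.one_smul]

variable (A)

/-- The differential of the disk. -/
def diskD (n i j : ℤ) : (A.cx.X (i - n) × A.cx.X (i - n + 1)) →ₗ[R]
    (A.cx.X (j - n) × A.cx.X (j - n + 1)) :=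
  ((A.cx.d (i - n) (j - n)).hom ∘ₗ LinearMap.fst R _ _).prod
    ((i - n).negOnePow • (tr A.cx (i - n) (j - n + 1) ∘ₗ LinearMap.fst R _ _) +
      (A.cx.d (i - n + 1) (j - n + 1)).hom ∘ₗ LinearMap.snd R _ _)

theorem diskD_apply (n i j : ℤ) (x : A.cx.X (i - n) × A.cx.X (i - n + 1)) :
    diskD A n i j x = ((A.cx.d (i - n) (j - n)).hom x.1,
      (i - n).negOnePow • tr A.cx (i - n) (j - n + 1) x.1 +
        (A.cx.d (i - n + 1) (j - n + 1)).hom x.2) := rfl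

/-- The DG module freely generated by an element `e` of degree `n` and its differential `e'`.
In degree `k` it consists of the elements `a e + b e'` with `|a| = k - n`, `|b| = k - n + 1`. -/
def disk (n : ℤ) : DGModule A :=
  ofData (fun k => A.cx.X (k - n) × A.cx.X (k - n + 1)) (diskD A n)
    (by
      intro i j h
      have : ¬ (i - n = j - n + 1) := by omega
      ext x <;> simp [diskD, d_eq_zero A.cx (i - n) (j - n) (by omega), tr, this,
        d_eq_zero A.cx (i - n + 1) (j - n + 1) (by omega)])
    (by
      intro i j k hj hk x
      have h2 : (i - n).negOnePow = - (j - n).negOnePow := by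
        rw [← Int.negOnePow_succ]; congr 1; omega
      ext
      · simp [diskD, d_d_apply]
      · simp [diskD, d_d_apply, tr_d A.cx (show j - n = k - n + 1 by omega), Units.smul_def,
          d_tr A.cx (show i - n = j - n + 1 by omega), h2])
    (fun {i j k} h => LinearMap.mk₂ R (fun a x => (A.mul (by omega) a x.1, A.mul (by omega) a x.2))
      (by intros; ext <;> simp) (by intros; ext <;> simp) (by intros; ext <;> simp)
      (by intros; ext <;> simp))
    (by intro i h m; ext <;> simp [A.one_mul])
    (by
      intro i j k ij jk l hij hjk h h' a b m
      ext
      · exact A.mul_assoc hij _ _ _ a b m.1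
      · exact A.mul_assoc hij _ _ _ a b m.2)
    (by
      intro i i' j j' k k' hi hj hk h h₁ h₂ a m
      have e1 := A.leibniz (j := j - n) (j' := j' - n) (k := k - n) (k' := k' - n) hi
        (by omega) (by omega) (by omega) (by omega) (by omega) a m.1
      have e2 := A.leibniz (j := j - n + 1) (j' := j' - n + 1) (k := k - n + 1)
        (k' := k' - n + 1) hi (by omega) (by omega) (by omega) (by omega) (by omega) a m.2
      have e3 := tr_mul (A := A) (i := i) (j := j - n) (k := k - n) (j' := j' - n + 1)
        (k' := k' - n + 1) (by omega) (by omega) (by omega) a m.1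
      have e4 : (k - n).negOnePow = i.negOnePow * (j - n).negOnePow := by
        rw [← Int.negOnePow_add]; congr 1; omega
      ext
      · simpa [diskD, Units.smul_def] using e1
      · simp only [diskD_apply, LinearMap.mk₂_apply, Units.smul_def, Prod.snd_add, Prod.smul_snd,
          e2, e3, e4, map_add, map_zsmul, smul_add, Units.val_mul,
          smul_smul]
        abel)

variable {A}

/-- The morphism from a disk determined by an element. -/
def diskDesc {M : DGModule A} {n : ℤ} (m : M.cx.X n) : disk A n ⟶ M :=
  mkHom (M := disk A n)
    (fun k => (M.smul (show k - n + n = k by omega)).flip m ∘ₗ LinearMap.fst R _ _ +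
      (M.smul (show k - n + 1 + (n - 1) = k by omega)).flip ((M.cx.d n (n - 1)).hom m) ∘ₗ
        LinearMap.snd R _ _)
    (by
      intro i j hij (x : A.cx.X (i - n) × A.cx.X (i - n + 1))
      have e1 := M.leibniz (i := i - n) (i' := j - n) (j := n) (j' := n - 1) (k := i) (k' := j)
        (by omega) (by omega) hij (by omega) (by omega) (by omega) x.1 m
      have e2 := M.leibniz (i := i - n + 1) (i' := j - n + 1) (j := n - 1) (j' := n - 1 - 1)
        (k := i) (k' := j) (by omega) (by omega) hij (by omega) (by omega) (by omega) x.2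
        ((M.cx.d n (n - 1)).hom m)
      have e3 := tr_smul M (show i - n + (n - 1) = j by omega)
        (show j - n + 1 + (n - 1) = j by omega) (show i - n = j - n + 1 by omega) x.1
        ((M.cx.d n (n - 1)).hom m)
      change M.smul _ (diskD A n i j x).1 m + M.smul _ (diskD A n i j x).2 _ =
        (M.cx.d i j).hom (M.smul _ x.1 m + M.smul _ x.2 _)
      rw [map_add, e1, e2, d_d_apply, diskD_apply]
      simp only [Units.smul_def, map_add, map_zsmul, LinearMap.add_apply, LinearMap.smul_apply, e3,
        map_zero, smul_zero, add_zero]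
      abel)
    (by
      intro i j k h a (x : A.cx.X (j - n) × A.cx.X (j - n + 1))
      have e1 := M.mul_smul (i := i) (j := j - n) (ij := k - n) (k := n) (jk := j) (l := k)
        (by omega) (by omega) (by omega) (by omega) a x.1 m
      have e2 := M.mul_smul (i := i) (j := j - n + 1) (ij := k - n + 1) (k := n - 1) (jk := j)
        (l := k) (by omega) (by omega) (by omega) (by omega) a x.2 ((M.cx.d n (n - 1)).hom m)
      refine (congrArg₂ (· + ·) e1 e2).trans ?_
      exact (map_add (M.smul h a) _ _).symm)

variable (A) in
/-- The generator of the disk. -/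
def diskGen (n : ℤ) : (disk A n).cx.X n :=
  ((tr A.cx 0 (n - n) A.one, 0) : A.cx.X (n - n) × A.cx.X (n - n + 1))

theorem diskDesc_gen {M : DGModule A} {n : ℤ} (m : M.cx.X n) :
    Hom.app (diskDesc m) n (diskGen A n) = m := by
  change M.smul _ (tr A.cx 0 (n - n) A.one) m + M.smul _ 0 _ = m
  rw [tr_one_smul M (by omega)]; simp

theorem disk_eq (n k : ℤ) (x : A.cx.X (k - n) × A.cx.X (k - n + 1)) :
    (disk A n).smul (show k - n + n = k by omega) x.1 (diskGen A n) +
      (disk A n).smul (show k - n + 1 + (n - 1) = k by omega) x.2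
        (((disk A n).cx.d n (n - 1)).hom (diskGen A n)) = x := by
  have h1 : ((disk A n).cx.d n (n - 1)).hom (diskGen A n) =
      ((0, tr A.cx 0 (n - 1 - n + 1) A.one) :
        A.cx.X (n - 1 - n) × A.cx.X (n - 1 - n + 1)) := by
    refine (diskD_apply A n n (n - 1) _).trans ?_
    refine Prod.ext (A.eq_zero_of_neg _ (by omega) _) ?_
    change (n - n).negOnePow • tr A.cx (n - n) (n - 1 - n + 1) (tr A.cx 0 (n - n) A.one) +
      (A.cx.d (n - n + 1) (n - 1 - n + 1)).hom 0 = _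
    simp [tr_tr A.cx (show 0 = n - n by omega) (show n - n = n - 1 - n + 1 by omega)]
  rw [h1]
  change ((A.mul _ x.1 (tr A.cx 0 (n - n) A.one), A.mul _ x.1 0) :
      A.cx.X (k - n) × A.cx.X (k - n + 1)) +
    (A.mul _ x.2 0, A.mul _ x.2 (tr A.cx 0 (n - 1 - n + 1) A.one)) = x
  rw [mul_tr_one (by omega), mul_tr_one (by omega), map_zero, map_zero]
  exact Prod.ext (add_zero _) (zero_add _)

theorem disk_hom_ext {M : DGModule A} {n : ℤ} (f g : disk A n ⟶ M)
    (h : Hom.app f n (diskGen A n) = Hom.app g n (diskGen A n)) : f = g := by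
  apply hom_ext'
  intro k x
  have := disk_eq (A := A) n k x
  rw [← this]
  simp only [map_add, app_smul, app_d, h]

instance disk_projective (n : ℤ) : Projective (disk A n) where
  factors {N M} f e he := by
    obtain ⟨m, hm⟩ := surjective_of_epi e n (Hom.app f n (diskGen A n))
    exact ⟨diskDesc m, disk_hom_ext _ _ (by rw [comp_app, diskDesc_gen, hm])⟩

instance enoughProjectives : EnoughProjectives (DGModule A) where
  presentation M := by
    let S := Σ n : ℤ, M.cx.X n
    let p : (∐ fun s : S => disk A s.1) ⟶ M := Sigma.desc fun s => diskDesc s.2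
    have hp : Epi p := by
      constructor
      intro W g h e
      apply hom_ext'
      intro i m
      have hx := diskDesc_gen m
      have h2 : diskDesc m ≫ g = diskDesc m ≫ h := by
        have := congrArg (fun q => Sigma.ι (fun s : S => disk A s.1) ⟨i, m⟩ ≫ q) e
        simpa [p] using this
      have h3 := congrArg (fun q => Hom.app q i (diskGen A i)) h2
      simpa [hx] using h3
    exact ⟨{ p := _, f := p }⟩

end Disk

section Ext

/-- The Yoneda Ext group `YExt^i_A(M, N)`: the `i`-th Ext group in the abelian category of
DG `A`-modules, i.e. the `i`-th cohomology of the complex of morphisms into `N` from a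
resolution of `M` by projective objects of this category. -/
noncomputable abbrev YExt (i : ℕ) (M N : DGModule A) : Type u :=
  ((Ext ℤ (DGModule A) i).obj (Opposite.op M)).obj N

/-- The `A`-linear homomorphisms `M ⟶ N` of degree `n`: families of `R`-linear maps
`f i j : M_i ⟶ N_j`, zero unless `j = i + n`, such that `f (a m) = (-1) ^ (n |a|) a f (m)`. -/
def homDeg (M N : DGModule A) (n : ℤ) :
    Submodule R (∀ i j : ℤ, M.cx.X i →ₗ[R] N.cx.X j) where
  carrier := { f | (∀ i j, i + n ≠ j → f i j = 0) ∧
    ∀ {i j k j' k' : ℤ} (h : i + j = k) (h' : i + j' = k') (a : A.cx.X i) (m : M.cx.X j),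
      f k k' (M.smul h a m) = (n * i).negOnePow • N.smul h' a (f j j' m) }
  zero_mem' := ⟨fun _ _ _ => rfl, by intros; simp⟩
  add_mem' := by
    rintro f g ⟨hf, hf'⟩ ⟨hg, hg'⟩
    exact ⟨fun i j h => by simp [hf i j h, hg i j h],
      fun h h' a m => by simp [hf' h h', hg' h h']⟩
  smul_mem' := by
    rintro r f ⟨hf, hf'⟩
    exact ⟨fun i j h => by simp [hf i j h],
      fun h h' a m => by simp [hf' h h', Units.smul_def, smul_comm r]⟩

/-- The differential `∂ f = ∂ ∘ f - (-1) ^ n f ∘ ∂` of the complex of homomorphisms. -/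
def homD (M N : DGModule A) (n n' : ℤ) (hn : n' + 1 = n) : homDeg M N n →ₗ[R] homDeg M N n' where
  toFun f := ⟨fun i j => (N.cx.d (j + 1) j).hom ∘ₗ f.1 i (j + 1) -
      n.negOnePow • (f.1 (i - 1) j ∘ₗ (M.cx.d i (i - 1)).hom), by
    obtain ⟨f, hf, hf'⟩ := f
    refine ⟨fun i j h => ?_, ?_⟩
    · simp [hf i (j + 1) (by omega), hf (i - 1) j (by omega)]
    · intro i j k j' k' h h' a m
      have e1 := hf' h (show i + (j' + 1) = k' + 1 by omega) a m
      have e2 := N.leibniz (i' := i - 1) (j' := j') (k' := k') (by omega) rfl rfl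
        (show i + (j' + 1) = k' + 1 by omega) (show i - 1 + (j' + 1) = k' by omega) h' a
        (f j (j' + 1) m)
      have e3 := M.leibniz (i' := i - 1) (j' := j - 1) (k' := k - 1) (by omega) (by omega)
        (by omega) h (show i - 1 + j = k - 1 by omega) (show i + (j - 1) = k - 1 by omega) a m
      have e4 := hf' (show i - 1 + j = k - 1 by omega) (show i - 1 + (j' + 1) = k' by omega)
        ((A.cx.d i (i - 1)).hom a) m
      have e5 := hf' (show i + (j - 1) = k - 1 by omega) h' a ((M.cx.d j (j - 1)).hom m)
      have s1 : (n * (i - 1)).negOnePow = (n * i).negOnePow * n.negOnePow := by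
        rw [← Int.negOnePow_sub]; congr 1; ring
      have s2 : (n' * i).negOnePow = (n * i).negOnePow * i.negOnePow := by
        rw [← Int.negOnePow_sub]; congr 1; rw [← hn]; ring
      simp only [LinearMap.sub_apply, LinearMap.comp_apply, LinearMap.smul_apply, Units.smul_def,
        map_sub, map_zsmul, map_add, e1, e2, e3, e4, e5, s1, s2]
      obtain h1 | h1 := Int.units_eq_one_or (n * i).negOnePow <;>
      obtain h2 | h2 := Int.units_eq_one_or n.negOnePow <;>
      obtain h3 | h3 := Int.units_eq_one_or i.negOnePow <;>
      simp [h1, h2, h3] <;> abel⟩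
  map_add' f g := by
    ext i j x
    simp
    abel
  map_smul' r f := by
    ext i j x
    simp [Units.smul_def, smul_sub, smul_comm r]

/-- The `R`-complex `Hom_A(M, N)`. -/
def homComplex (M N : DGModule A) : ChainComplex (ModuleCat.{u} R) ℤ where
  X n := ModuleCat.of R (homDeg M N n)
  d n n' := if h : n' + 1 = n then ModuleCat.ofHom (homD M N n n' h) else 0
  shape n n' h := dif_neg h
  d_comp_d' := by
    intro n n' n'' (h : n' + 1 = n) (h' : n'' + 1 = n')
    rw [dif_pos h, dif_pos h']
    have s : n.negOnePow = -n'.negOnePow := by rw [← h, Int.negOnePow_succ]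
    ext f i j x
    change (N.cx.d (j + 1) j).hom ((N.cx.d (j + 1 + 1) (j + 1)).hom (f.1 i (j + 1 + 1) x) -
        n.negOnePow • f.1 (i - 1) (j + 1) ((M.cx.d i (i - 1)).hom x)) -
      n'.negOnePow • ((N.cx.d (j + 1) j).hom (f.1 (i - 1) (j + 1) ((M.cx.d i (i - 1)).hom x)) -
        n.negOnePow • f.1 (i - 1 - 1) j
          ((M.cx.d (i - 1) (i - 1 - 1)).hom ((M.cx.d i (i - 1)).hom x))) = 0
    simp [d_d_apply, s, Units.smul_def]

/-- The chain map `Hom_A(M, g) : Hom_A(M, N) ⟶ Hom_A(M, N')`. -/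
def homMap (M : DGModule A) {N N' : DGModule A} (g : N ⟶ N') :
    homComplex M N ⟶ homComplex M N' where
  f n := ModuleCat.ofHom
    { toFun := fun f => (⟨fun i j => Hom.app g j ∘ₗ f.1 i j, by
        obtain ⟨f, hf, hf'⟩ := f
        exact ⟨fun i j h => by simp [hf i j h],
          fun h h' a m => by simp [hf' h h', Units.smul_def, app_smul]⟩⟩ : homDeg M N' n)
      map_add' := by intros; ext; simp
      map_smul' := by intros; ext; simp }
  comm' := by
    intro n n' (h : n' + 1 = n)
    simp only [homComplex, dif_pos h]
    ext f i j x
    change (N'.cx.d (j + 1) j).hom (Hom.app g (j + 1) (f.1 i (j + 1) x)) -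
        n.negOnePow • Hom.app g j (f.1 (i - 1) j ((M.cx.d i (i - 1)).hom x)) =
      Hom.app g j ((N.cx.d (j + 1) j).hom (f.1 i (j + 1) x) -
        n.negOnePow • f.1 (i - 1) j ((M.cx.d i (i - 1)).hom x))
    simp [app_d, Units.smul_def]

/-- A morphism of DG modules is a quasiisomorphism if it induces isomorphisms in homology. -/
def IsQuasiIso {M N : DGModule A} (f : M ⟶ N) : Prop := QuasiIso (Hom.hom f)

/-- `Q` is graded-projective if `Hom_A(Q, -)` preserves surjective morphisms. -/
def IsGradedProjective (Q : DGModule A) : Prop :=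
  ∀ ⦃M N : DGModule A⦄ (g : M ⟶ N), (∀ i, Function.Surjective (Hom.app g i)) →
    ∀ n, Function.Surjective ((homMap Q g).f n).hom

/-- `Q` is semi-projective if it is graded-projective and `Hom_A(Q, -)` preserves
quasiisomorphisms. -/
def IsSemiProjective (Q : DGModule A) : Prop :=
  IsGradedProjective Q ∧
    ∀ ⦃M N : DGModule A⦄ (g : M ⟶ N), IsQuasiIso g → QuasiIso (homMap Q g)

/-- A semi-projective resolution of `M`: a quasiisomorphism `P ⟶ M` with `P` semi-projective. -/
structure SemiProjectiveResolution (M : DGModule A) where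
  /-- the resolving DG module -/
  P : DGModule A
  /-- the quasiisomorphism -/
  π : P ⟶ M
  isQuasiIso : IsQuasiIso π
  isSemiProjective : IsSemiProjective P

/-- A semi-projective DG module is a semi-projective resolution of itself. -/
def SemiProjectiveResolution.self (Q : DGModule A) (hQ : IsSemiProjective Q) :
    SemiProjectiveResolution Q where
  P := Q
  π := 𝟙 Q
  isQuasiIso := inferInstanceAs (QuasiIso (𝟙 Q.cx))
  isSemiProjective := hQ

/-- `RHom_A(M, N) = Hom_A(P, N)` for a semi-projective resolution `P` of `M`. -/
def SemiProjectiveResolution.RHom {M : DGModule A} (P : SemiProjectiveResolution M)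
    (N : DGModule A) : ChainComplex (ModuleCat.{u} R) ℤ := homComplex P.P N

/-- `Ext^i_A(M, N) = H_{-i}(RHom_A(M, N))`, computed by a semi-projective resolution of `M`. -/
noncomputable abbrev SemiProjectiveResolution.DGExt {M : DGModule A}
    (P : SemiProjectiveResolution M) (i : ℤ) (N : DGModule A) : Type u :=
  (P.RHom N).homology (-i)

end Ext

end DGModule

/-! The complex `Hom_A(Q, N)` in degrees `≤ 0` is itself a complex of morphisms out of a projective
resolution of `Q` in the abelian category. For each `n` let `cyl Q n` be the DG module freely
generated by the shifted graded module underlying `Q`: every generator comes with a formal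
differential. Forgetting the differential of `Q` in this way means that a morphism `cyl Q n ⟶ N` is
an arbitrary homomorphism of degree `-n` from `Q` to `N`, with no cycle condition (`cylEquiv`). Two
consequences follow.

Lifting morphisms from `cyl Q n` along an epimorphism is the surjectivity of `Hom_A(Q, -)` in degree
`-n`, so `cyl Q n` is projective as soon as `Q` is graded-projective (`cyl_projective`). Moreover
the maps `cylδ`, which send a generator to a formal differential, splice the extensions of one shift
of `Q` by the next into an exact sequence `⋯ ⟶ cyl Q 1 ⟶ cyl Q 0 ⟶ Q ⟶ 0`, and precomposition with
`cylδ` is exactly `∂` (`cylRestrict_cylδ`). Hence `YExt^i` is the cohomology of `Hom_A(Q, N)_0 ⟶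
Hom_A(Q, N)_{-1} ⟶ ⋯`. For `i ≥ 1` this is `H_{-i}(Hom_A(Q, N))`; for `i = 0` the boundaries coming
from degree `1` would be missing.

It remains to replace `Q` by another semi-projective resolution `P`. A quasiisomorphism between
semi-projective DG modules is a homotopy equivalence, by the usual Whitehead argument, and
homotopies survive `Hom_A(-, N)` (`nonempty_homotopyEquiv`). -/

namespace CategoryTheory.ShortComplex

/-! ### Homology of short complexes of modules in terms of elements -/

section

universe v w

variable {S : Type v} [Ring S] (K : ShortComplex (ModuleCat.{u} S))

/-- The homology class of a cycle of a short complex of modules. -/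
noncomputable def moduleCatClass : LinearMap.ker K.g.hom →ₗ[S] K.homology :=
  (K.moduleCatCyclesIso.inv ≫ K.homologyπ).hom

theorem moduleCatClass_eq : K.moduleCatClass =
    (K.moduleCatLeftHomologyData.π ≫ K.moduleCatHomologyIso.inv).hom := by
  rw [← moduleCatCyclesIso_inv_π]; rfl

theorem moduleCatClass_surjective : Function.Surjective K.moduleCatClass := by
  rw [moduleCatClass_eq]
  exact Function.Surjective.comp (g := K.moduleCatHomologyIso.inv.hom)
    ((ModuleCat.epi_iff_surjective K.moduleCatHomologyIso.inv).1 inferInstance)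
    (Submodule.mkQ_surjective (LinearMap.range K.moduleCatToCycles))

theorem moduleCatClass_eq_zero_iff (x : LinearMap.ker K.g.hom) :
    K.moduleCatClass x = 0 ↔ ∃ y, K.f.hom y = x.1 := by
  have hinj : Function.Injective K.moduleCatHomologyIso.inv.hom :=
    (ModuleCat.mono_iff_injective K.moduleCatHomologyIso.inv).1 inferInstance
  rw [moduleCatClass_eq]
  refine (map_eq_zero_iff K.moduleCatHomologyIso.inv.hom hinj).trans ?_
  refine (Submodule.Quotient.mk_eq_zero (LinearMap.range K.moduleCatToCycles)).trans ?_
  exact exists_congr fun y => Subtype.ext_iff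

theorem map_mem_ker {K L : ShortComplex (ModuleCat.{u} S)} (φ : K ⟶ L)
    (x : LinearMap.ker K.g.hom) : φ.τ₂.hom x.1 ∈ LinearMap.ker L.g.hom := by
  have h := congrArg (fun q => q.hom x.1) φ.comm₂₃
  refine LinearMap.mem_ker.2 (h.trans ?_)
  exact (congrArg φ.τ₃.hom x.2).trans (map_zero _)

theorem homologyMap_moduleCatClass {K L : ShortComplex (ModuleCat.{u} S)} (φ : K ⟶ L)
    (x : LinearMap.ker K.g.hom) :
    (homologyMap φ).hom (K.moduleCatClass x) = L.moduleCatClass ⟨φ.τ₂.hom x.1, map_mem_ker φ x⟩ := by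
  have h1 := congrArg (fun q => q.hom (K.moduleCatCyclesIso.inv.hom x)) (homologyπ_naturality φ)
  refine h1.trans ?_
  change L.homologyπ.hom ((cyclesMap φ).hom _) = L.homologyπ.hom (L.moduleCatCyclesIso.inv.hom _)
  congr 1
  apply (ModuleCat.mono_iff_injective L.iCycles).1 inferInstance
  have h2 := congrArg (fun q => q.hom (K.moduleCatCyclesIso.inv.hom x)) (cyclesMap_i φ)
  refine h2.trans ?_
  have h3 := congrArg (fun q => q.hom x) K.moduleCatCyclesIso_inv_iCycles
  refine (congrArg φ.τ₂.hom h3).trans ?_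
  exact (congrArg (fun q => q.hom (⟨φ.τ₂.hom x.1, map_mem_ker φ x⟩ : LinearMap.ker L.g.hom))
    L.moduleCatCyclesIso_inv_iCycles).symm

/-- Surjectivity on homology in terms of elements: a cycle of the target lifts up to a boundary. -/
theorem exists_cycle_of_quasiIso {K L : ShortComplex (ModuleCat.{u} S)} (φ : K ⟶ L)
    [hφ : QuasiIso φ] (z : L.X₂) (hz : L.g.hom z = 0) :
    ∃ w, K.g.hom w = 0 ∧ ∃ t, L.f.hom t = φ.τ₂.hom w - z := by
  have hs : Function.Surjective (homologyMap φ).hom :=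
    (ModuleCat.epi_iff_surjective (homologyMap φ)).1 (have := hφ.isIso'; inferInstance)
  obtain ⟨c, hc⟩ := hs (L.moduleCatClass ⟨z, hz⟩)
  obtain ⟨w, rfl⟩ := K.moduleCatClass_surjective c
  refine ⟨w.1, w.2, ?_⟩
  rw [homologyMap_moduleCatClass, ← sub_eq_zero, ← map_sub, moduleCatClass_eq_zero_iff] at hc
  exact hc

/-- Injectivity on homology in terms of elements: a cycle whose image bounds is itself a boundary.
-/
theorem exists_boundary_of_quasiIso {K L : ShortComplex (ModuleCat.{u} S)} (φ : K ⟶ L)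
    [hφ : QuasiIso φ] (w : K.X₂) (hw : K.g.hom w = 0) (t : L.X₁) (ht : L.f.hom t = φ.τ₂.hom w) :
    ∃ s, K.f.hom s = w := by
  have hs : Function.Injective (homologyMap φ).hom :=
    (ModuleCat.mono_iff_injective (homologyMap φ)).1 (have := hφ.isIso'; inferInstance)
  refine (K.moduleCatClass_eq_zero_iff ⟨w, hw⟩).1 (hs ?_)
  rw [homologyMap_moduleCatClass, map_zero, moduleCatClass_eq_zero_iff]
  exact ⟨t, ht⟩

/-- Additively isomorphic short complexes of modules, possibly over different rings, have
additively isomorphic homology. -/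
theorem nonempty_homology_addEquiv {T : Type w} [Ring T] (L : ShortComplex (ModuleCat.{u} T))
    (e₁ : K.X₁ ≃+ L.X₁) (e₂ : K.X₂ ≃+ L.X₂) (e₃ : K.X₃ ≃+ L.X₃)
    (h₁₂ : ∀ x, e₂ (K.f.hom x) = L.f.hom (e₁ x)) (h₂₃ : ∀ x, e₃ (K.g.hom x) = L.g.hom (e₂ x)) :
    Nonempty (K.homology ≃+ L.homology) := by
  let e : LinearMap.ker K.g.hom ≃+ LinearMap.ker L.g.hom :=
    { toFun := fun x => ⟨e₂ x.1, by
        rw [LinearMap.mem_ker, ← h₂₃, x.2, map_zero]⟩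
      invFun := fun y => ⟨e₂.symm y.1, by
        rw [LinearMap.mem_ker, ← map_eq_zero_iff e₃ e₃.injective, h₂₃, e₂.apply_symm_apply, y.2]⟩
      left_inv := fun x => Subtype.ext (e₂.symm_apply_apply _)
      right_inv := fun x => Subtype.ext (e₂.apply_symm_apply _)
      map_add' := fun x y => Subtype.ext (map_add e₂ _ _) }
  let p := K.moduleCatClass.toAddMonoidHom
  let q := L.moduleCatClass.toAddMonoidHom
  -- Both homologies are quotients of cycles by boundaries, so it is enough that `e` matches the
  -- boundaries; here `e₁` carries the bounding elements across.
  have hpq : p.ker.map (e : LinearMap.ker K.g.hom →+ LinearMap.ker L.g.hom) = q.ker := by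
    ext y
    rw [AddSubgroup.mem_map]
    constructor
    · rintro ⟨x, hx, rfl⟩
      obtain ⟨t, ht⟩ := (K.moduleCatClass_eq_zero_iff x).1 hx
      refine (L.moduleCatClass_eq_zero_iff (e x)).2 ⟨e₁ t, ?_⟩
      rw [← h₁₂, ht]; rfl
    · intro hy
      obtain ⟨t, ht⟩ := (L.moduleCatClass_eq_zero_iff y).1 hy
      refine ⟨e.symm y, (K.moduleCatClass_eq_zero_iff _).2 ⟨e₁.symm t, ?_⟩, e.apply_symm_apply y⟩
      apply e₂.injective
      rw [h₁₂, e₁.apply_symm_apply, ht]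
      exact (e₂.apply_symm_apply _).symm
  exact ⟨(QuotientAddGroup.quotientKerEquivOfSurjective p K.moduleCatClass_surjective).symm.trans
    ((QuotientAddGroup.congr p.ker q.ker e hpq).trans
      (QuotientAddGroup.quotientKerEquivOfSurjective q L.moduleCatClass_surjective))⟩

end

end CategoryTheory.ShortComplex

namespace DGModule

variable {R : Type u} [CommRing R] {A : DGAlgebra R}

/-! ### The complex of homomorphisms in terms of elements -/

theorem homDeg_ext {M N : DGModule A} {n : ℤ} {f g : homDeg M N n}
    (h : ∀ i j, i + n = j → ∀ x, f.1 i j x = g.1 i j x) : f = g := by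
  ext i j x
  by_cases hij : i + n = j
  · exact h i j hij x
  · rw [f.2.1 i j hij, g.2.1 i j hij]

theorem homDeg_tr {M N : DGModule A} {n : ℤ} (f : homDeg M N n) {i i' : ℤ} (h : i = i') (j : ℤ)
    (x : M.cx.X i) : f.1 i' j (tr M.cx i i' x) = f.1 i j x := by
  subst h; simp

/-- With all degrees free and tied only by equations, the formula can be used in whatever shape the
indices take, without transport along `i - 1` or `j + 1`. -/
theorem homD_apply {M N : DGModule A} {n n' : ℤ} (hn : n' + 1 = n) (f : homDeg M N n)
    {i i' j j' : ℤ} (hi : i' + 1 = i) (hj : j' + 1 = j) (x : M.cx.X i) :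
    (homD M N n n' hn f).1 i j' x = (N.cx.d j j').hom (f.1 i j x) -
      n.negOnePow • f.1 i' j' ((M.cx.d i i').hom x) := by
  subst hj
  obtain rfl : i' = i - 1 := by omega
  rfl

theorem homComplex_d {M N : DGModule A} {n n' : ℤ} (hn : n' + 1 = n) :
    (homComplex M N).d n n' = ModuleCat.ofHom (homD M N n n' hn) :=
  dif_pos hn

theorem homComplex_d_apply {M N : DGModule A} {n n' : ℤ} (hn : n' + 1 = n) (f : homDeg M N n) :
    ((homComplex M N).d n n').hom f = homD M N n n' hn f := by
  rw [homComplex_d hn]; rfl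

theorem homD_homD {M N : DGModule A} {n n' n'' : ℤ} (hn : n' + 1 = n) (hn' : n'' + 1 = n')
    (f : homDeg M N n) : homD M N n' n'' hn' (homD M N n n' hn f) = 0 := by
  have := d_d_apply (homComplex M N) n n' n'' f
  rw [homComplex_d hn, homComplex_d hn'] at this
  exact this

/-- A morphism of DG modules as an element of degree zero of the complex of homomorphisms. -/
def homDegOfHom {M N : DGModule A} (f : M ⟶ N) : homDeg M N 0 :=
  ⟨fun i j => tr N.cx i j ∘ₗ Hom.app f i, fun i j h => by
    ext x; simp [tr, show i ≠ j by omega], by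
    intro i j k j' k' h h' a m
    obtain rfl | hj : j = j' ∨ j ≠ j' := em _
    · obtain rfl : k = k' := by omega
      simp [app_smul]
    · have : k ≠ k' := by omega
      simp [tr, this, hj]⟩

theorem homDegOfHom_apply {M N : DGModule A} (f : M ⟶ N) (i : ℤ) (x : M.cx.X i) :
    (homDegOfHom f).1 i i x = Hom.app f i x := by
  simp [homDegOfHom]

theorem homD_homDegOfHom {M N : DGModule A} (f : M ⟶ N) {n : ℤ} (hn : n + 1 = 0) :
    homD M N 0 n hn (homDegOfHom f) = 0 := by
  apply homDeg_ext
  intro i j hij x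
  rw [homD_apply hn _ (i' := j) (j := i) (by omega) (by omega), homDegOfHom_apply,
    homDegOfHom_apply, app_d]
  simp

/-- The morphism of DG modules given by a cycle of degree zero. -/
def homOfHomDeg {M N : DGModule A} (f : homDeg M N 0) (hf : homD M N 0 (-1) rfl f = 0) : M ⟶ N :=
  mkHom (fun i => f.1 i i)
    (fun i j h m => by
      have := homD_apply (n := 0) (n' := -1) rfl f h h m
      rw [hf] at this
      simpa using (sub_eq_zero.1 this.symm).symm)
    (fun h a m => by simpa using f.2.2 h h a m)

/-! ### Precomposition and homotopies -/

/-- Composition of a homomorphism with a homomorphism of degree one. -/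
def homDegCompOne {L M N : DGModule A} {n m : ℤ} (hm : n + 1 = m) (s : homDeg L M 1) :
    homDeg M N n →ₗ[R] homDeg L N m where
  toFun f := ⟨fun i j => f.1 (i + 1) j ∘ₗ s.1 i (i + 1),
    fun i j h => by dsimp only; rw [f.2.1 (i + 1) j (by omega), LinearMap.zero_comp], by
    intro i j k j' k' h h' a x
    have e1 := s.2.2 h (show i + (j + 1) = k + 1 by omega) a x
    have e2 := f.2.2 (show i + (j + 1) = k + 1 by omega) h' a (s.1 j (j + 1) x)
    have e3 : (m * i).negOnePow = (1 * i).negOnePow * (n * i).negOnePow := by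
      rw [← Int.negOnePow_add]; congr 1; rw [← hm]; ring
    simp only [LinearMap.comp_apply, e1, Units.smul_def, map_zsmul, e2, e3, Units.val_mul,
      smul_smul]⟩
  map_add' f g := rfl
  map_smul' r f := rfl

theorem homDegCompOne_apply {L M N : DGModule A} {n m : ℤ} (hm : n + 1 = m) (s : homDeg L M 1)
    (f : homDeg M N n) {i i' : ℤ} (hi : i + 1 = i') (j : ℤ) (x : L.cx.X i) :
    (homDegCompOne hm s f).1 i j x = f.1 i' j (s.1 i i' x) := by
  subst hi; rfl

/-- Precomposition of a homomorphism with a morphism. -/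
def homDegPrecomp {M M' : DGModule A} (f : M ⟶ M') (N : DGModule A) (n : ℤ) :
    homDeg M' N n →ₗ[R] homDeg M N n where
  toFun φ := ⟨fun i j => φ.1 i j ∘ₗ Hom.app f i,
    fun i j h => by dsimp only; rw [φ.2.1 i j h, LinearMap.zero_comp],
    fun h h' a m => by simp only [LinearMap.comp_apply, app_smul, φ.2.2 h h']⟩
  map_add' _ _ := rfl
  map_smul' _ _ := rfl

theorem homDegPrecomp_apply {M M' : DGModule A} (f : M ⟶ M') {N : DGModule A} {n : ℤ}
    (φ : homDeg M' N n) (i j : ℤ) (x : M.cx.X i) :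
    (homDegPrecomp f N n φ).1 i j x = φ.1 i j (Hom.app f i x) := rfl

theorem homD_homDegPrecomp {M M' : DGModule A} (f : M ⟶ M') (N : DGModule A) {n n' : ℤ}
    (h : n' + 1 = n) (φ : homDeg M' N n) :
    homD M N n n' h (homDegPrecomp f N n φ) = homDegPrecomp f N n' (homD M' N n n' h φ) := by
  apply homDeg_ext
  intro i j hij x
  rw [homD_apply h _ (sub_add_cancel i 1) rfl, homDegPrecomp_apply, homDegPrecomp_apply,
    homDegPrecomp_apply, homD_apply h _ (sub_add_cancel i 1) rfl, app_d]

/-- The chain map `Hom_A(f, N) : Hom_A(M', N) ⟶ Hom_A(M, N)`. -/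
def homPrecomp {M M' : DGModule A} (f : M ⟶ M') (N : DGModule A) :
    homComplex M' N ⟶ homComplex M N where
  f n := ModuleCat.ofHom (homDegPrecomp f N n)
  comm' n n' h := by
    rw [homComplex_d h, homComplex_d h]
    exact ModuleCat.hom_ext (LinearMap.ext fun φ => homD_homDegPrecomp f N h φ)

/-- This is the Leibniz rule `∂(φ s) = ∂(φ) s + (-1)^n φ ∂(s)` for `φ` of degree `n`, with `∂(s) = f
- g` inserted. -/
theorem homD_homDegCompOne {L M N : DGModule A} {f g : L ⟶ M} (s : homDeg L M 1)
    (hs : homD L M 1 0 rfl s = homDegOfHom f - homDegOfHom g) {n n' : ℤ} (hn : n' + 1 = n)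
    (φ : homDeg M N n) (i j : ℤ) (x : L.cx.X i) :
    (homD L N (n + 1) n rfl (homDegCompOne rfl s φ)).1 i j x -
      (homDegCompOne hn s (homD M N n n' hn φ)).1 i j x =
    n.negOnePow • (φ.1 i j (Hom.app f i x) - φ.1 i j (Hom.app g i x)) := by
  have hsx : (homD L M 1 0 rfl s).1 i i x = Hom.app f i x - Hom.app g i x := by
    rw [hs, ← homDegOfHom_apply, ← homDegOfHom_apply]; rfl
  rw [homD_apply (n := 1) (n' := 0) rfl s (i' := i - 1) (j := i + 1) (by omega) rfl] at hsx
  rw [homD_apply rfl _ (i' := i - 1) (j := j + 1) (by omega) rfl,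
    homDegCompOne_apply rfl s φ rfl, homDegCompOne_apply rfl s φ (i' := i) (by omega),
    homDegCompOne_apply hn s _ rfl,
    homD_apply hn φ (i' := i) (j := j + 1) rfl rfl, ← map_sub, ← hsx]
  simp only [Int.negOnePow_succ, Int.negOnePow_one, Units.smul_def, map_sub, map_zsmul,
    Units.val_neg, Units.val_one, neg_smul, map_neg]
  obtain h | h := Int.units_eq_one_or n.negOnePow <;> simp [h] <;> abel

/-- The Leibniz rule rearranged into the homotopy identity for `φ ↦ (-1)^n φ s`: as `∂φ` has degree
`n - 1`, its sign is opposite to that of `φ`, which turns the difference into a sum. -/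
theorem homDegPrecomp_eq_add {L M N : DGModule A} {f g : L ⟶ M} (s : homDeg L M 1)
    (hs : homD L M 1 0 rfl s = homDegOfHom f - homDegOfHom g) {n n' : ℤ} (hn : n' + 1 = n)
    (φ : homDeg M N n) (i j : ℤ) (x : L.cx.X i) :
    (homDegPrecomp f N n φ).1 i j x =
      ((n'.negOnePow • homDegCompOne hn s (homD M N n n' hn φ)).1 i j x +
      (homD L N (n + 1) n rfl (n.negOnePow • homDegCompOne rfl s φ)).1 i j x) +
      (homDegPrecomp g N n φ).1 i j x := by
  have key := homD_homDegCompOne s hs hn φ i j x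
  have e : n'.negOnePow = -n.negOnePow := by
    rw [← hn, Int.negOnePow_succ, neg_neg]
  rw [e, homDegPrecomp_apply, homDegPrecomp_apply, ← sub_eq_iff_eq_add]
  obtain h | h := Int.units_eq_one_or n.negOnePow <;> rw [h] at key ⊢ <;>
  simp only [Units.smul_def, Units.val_neg, Units.val_one, neg_smul, one_zsmul, neg_neg, map_neg,
    NegMemClass.coe_neg, Pi.neg_apply, LinearMap.neg_apply] at key ⊢
  · rw [← key]; abel
  · rw [← neg_eq_iff_eq_neg] at key
    rw [← key]; abel

/-- The components of the homotopy given by composition with a homomorphism of degree one. -/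
noncomputable def homPrecompHomotopyHom {L M : DGModule A} (s : homDeg L M 1) (N : DGModule A)
    (n m : ℤ) : (homComplex M N).X n ⟶ (homComplex L N).X m :=
  -- The sign cancels the `(-1)^n` in front of `φ ∂(s)` in the Leibniz rule.
  if h : n + 1 = m then ModuleCat.ofHom (n.negOnePow • homDegCompOne h s) else 0

theorem homPrecompHomotopyHom_eq {L M : DGModule A} (s : homDeg L M 1) (N : DGModule A)
    {n m : ℤ} (h : n + 1 = m) : homPrecompHomotopyHom s N n m =
      ModuleCat.ofHom (n.negOnePow • homDegCompOne h s) :=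
  dif_pos h

/-- Precompositions with homotopic morphisms are homotopic. -/
noncomputable def homPrecompHomotopy {L M : DGModule A} {f g : L ⟶ M} (s : homDeg L M 1)
    (hs : homD L M 1 0 rfl s = homDegOfHom f - homDegOfHom g) (N : DGModule A) :
    Homotopy (homPrecomp f N) (homPrecomp g N) where
  hom := homPrecompHomotopyHom s N
  zero n m h := dif_neg h
  comm n := by
    rw [dNext_eq _ (show (ComplexShape.down ℤ).Rel n (n - 1) from sub_add_cancel n 1),
      prevD_eq _ (show (ComplexShape.down ℤ).Rel (n + 1) n from rfl),
      homPrecompHomotopyHom_eq s N (sub_add_cancel n 1),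
      homPrecompHomotopyHom_eq s N rfl, homComplex_d (sub_add_cancel n 1),
      homComplex_d rfl]
    ext φ
    apply homDeg_ext
    intro i j _ x
    exact homDegPrecomp_eq_add s hs (sub_add_cancel n 1) φ i j x

/-! ### Uniqueness of semi-projective resolutions up to homotopy -/

/-- Quasiisomorphic semi-projective DG modules have homotopy equivalent complexes of
homomorphisms. -/
theorem nonempty_homotopyEquiv {P Q : DGModule A} (hP : IsSemiProjective P)
    (hQ : IsSemiProjective Q) (f : P ⟶ Q) (hf : IsQuasiIso f) (N : DGModule A) :
    Nonempty (HomotopyEquiv (homComplex Q N) (homComplex P N)) := by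
  have h1 := hQ.2 f hf
  have h2 := hP.2 f hf
  -- Only degree zero matters, because morphisms are the cycles of degree zero and homotopies are
  -- the elements bounding their differences.
  have q1 := (quasiIsoAt_iff' (homMap Q f) 1 0 (-1) (by simp) (by simp)).1 inferInstance
  have q2 := (quasiIsoAt_iff' (homMap P f) 1 0 (-1) (by simp) (by simp)).1 inferInstance
  -- Lifting the class of the identity along `Hom_A(Q, P) ⟶ Hom_A(Q, Q)` gives the homotopy inverse
  -- `g`, together with a homotopy `s` from `g ≫ f` to the identity.
  obtain ⟨w, hw, s, hs⟩ := ShortComplex.exists_cycle_of_quasiIso _ (hφ := q1) (homDegOfHom (𝟙 Q))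
    ((homComplex_d_apply _ _).trans (homD_homDegOfHom (𝟙 Q) rfl))
  change homDeg Q P 0 at w
  change homDeg Q Q 1 at s
  let g := homOfHomDeg w ((homComplex_d_apply _ _).symm.trans hw)
  have hs' : homD Q Q 1 0 rfl s = homDegOfHom (g ≫ f) - homDegOfHom (𝟙 Q) := by
    refine ((homComplex_d_apply _ _).symm.trans hs).trans ?_
    apply homDeg_ext
    rintro i j hij x
    obtain rfl : i = j := by omega
    change Hom.app f i (w.1 i i x) - (homDegOfHom (𝟙 Q)).1 i i x =
      (homDegOfHom (g ≫ f)).1 i i x - (homDegOfHom (𝟙 Q)).1 i i x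
    rw [homDegOfHom_apply (g ≫ f)]
    rfl
  -- On the other side, `f ≫ g` minus the identity of `P`, followed by `f`, equals `f` followed by
  -- `g ≫ f` minus the identity of `Q`. This bounds, by `s` precomposed with `f`, so injectivity of
  -- `Hom_A(P, f)` on homology supplies the second homotopy.
  obtain ⟨t, ht⟩ := ShortComplex.exists_boundary_of_quasiIso _ (hφ := q2)
    (homDegOfHom (f ≫ g) - homDegOfHom (𝟙 P))
    ((homComplex_d_apply (n' := -1) rfl _).trans (by
      refine (map_sub (homD P P 0 (-1) rfl) _ _).trans ?_
      exact sub_eq_zero.2 ((homD_homDegOfHom _ rfl).trans (homD_homDegOfHom _ rfl).symm)))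
    (homDegPrecomp f Q 1 s) (by
      refine (homComplex_d_apply (by omega) (homDegPrecomp f Q 1 s)).trans ?_
      rw [homD_homDegPrecomp, hs']
      apply homDeg_ext
      rintro i j hij x
      obtain rfl : i = j := by omega
      change (homDegOfHom (g ≫ f)).1 i i (Hom.app f i x) -
        (homDegOfHom (𝟙 Q)).1 i i (Hom.app f i x) =
        Hom.app f i ((homDegOfHom (f ≫ g)).1 i i x - (homDegOfHom (𝟙 P)).1 i i x)
      simp only [homDegOfHom_apply, map_sub, comp_app, id_app])
  change homDeg P P 1 at t
  have ht' : homD P P 1 0 rfl t = homDegOfHom (f ≫ g) - homDegOfHom (𝟙 P) :=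
    (homComplex_d_apply _ _).symm.trans ht
  exact ⟨{
    hom := homPrecomp f N
    inv := homPrecomp g N
    homotopyHomInvId := homPrecompHomotopy s hs' N
    homotopyInvHomId := homPrecompHomotopy t ht' N }⟩

/-! ### Free DG modules on the shifts of a graded module -/

section Cylinder

theorem smul_tr (M : DGModule A) {i j k j' k' : ℤ} (h : i + j = k) (h' : i + j' = k')
    (hj : j = j') (a : A.cx.X i) (m : M.cx.X j) :
    tr M.cx k k' (M.smul h a m) = M.smul h' a (tr M.cx j j' m) := by
  subst hj; subst h; subst h'; simp

theorem tr_of_ne (C : ChainComplex (ModuleCat.{u} R) ℤ) {i j : ℤ} (h : i ≠ j) (x : C.X i) :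
    tr C i j x = 0 := by
  simp [tr, h]

variable (M : DGModule A)

/-- The differential of the free DG module on a shift of the underlying graded module. -/
def cylD (n i j : ℤ) : (M.cx.X (i + n) × M.cx.X (i + n + 1)) →ₗ[R]
    (M.cx.X (j + n) × M.cx.X (j + n + 1)) :=
  -- In a pair `(x, y)` the entry `x` is a generator and `y` a formal differential. The differential
  -- of `(x, 0)` has second entry `x` and first entry the shifted differential of `M`. This
  -- presentation makes the second summand a DG submodule and the projection to the first a morphism
  -- onto the shift of `M`.
  (n.negOnePow • ((M.cx.d (i + n) (j + n)).hom ∘ₗ LinearMap.fst R _ _)).prod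
    (tr M.cx (i + n) (j + n + 1) ∘ₗ LinearMap.fst R _ _ -
      n.negOnePow • ((M.cx.d (i + n + 1) (j + n + 1)).hom ∘ₗ LinearMap.snd R _ _))

theorem cylD_apply (n i j : ℤ) (x : M.cx.X (i + n) × M.cx.X (i + n + 1)) :
    cylD M n i j x = (n.negOnePow • (M.cx.d (i + n) (j + n)).hom x.1,
      tr M.cx (i + n) (j + n + 1) x.1 -
        n.negOnePow • (M.cx.d (i + n + 1) (j + n + 1)).hom x.2) := rfl

/-- The scalar multiplication of the free DG module on a shift of the underlying graded
module. -/
def cylSMul (n : ℤ) {i j k : ℤ} (h : i + j = k) : A.cx.X i →ₗ[R]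
    (M.cx.X (j + n) × M.cx.X (j + n + 1)) →ₗ[R] (M.cx.X (k + n) × M.cx.X (k + n + 1)) :=
  -- A scalar passes a shift of degree `-n` in the first summand and of degree `-(n + 1)` in the
  -- second. These signs turn homomorphisms of degree `-n` into strictly `A`-linear maps.
  LinearMap.mk₂ R (fun a x => ((n * i).negOnePow • M.smul (by omega) a x.1,
      ((n + 1) * i).negOnePow • M.smul (by omega) a x.2))
    (by intros; ext <;> simp [Units.smul_def])
    (by intro r _ _; ext <;> simp [Units.smul_def, smul_comm r])
    (by intros; ext <;> simp [Units.smul_def])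
    (by intro r _ _; ext <;> simp [Units.smul_def, smul_comm r])

theorem cylSMul_apply (n : ℤ) {i j k : ℤ} (h : i + j = k) (a : A.cx.X i)
    (x : M.cx.X (j + n) × M.cx.X (j + n + 1)) :
    cylSMul M n h a x = ((n * i).negOnePow • M.smul (by omega) a x.1,
      ((n + 1) * i).negOnePow • M.smul (by omega) a x.2) := rfl

/-- The free DG module on the underlying graded module of `M` shifted by `n`. -/
def cyl (n : ℤ) : DGModule A :=
  ofData (fun k => M.cx.X (k + n) × M.cx.X (k + n + 1)) (cylD M n)
    (by
      intro i j h
      ext x <;> simp [cylD, d_eq_zero M.cx (i + n) (j + n) (by omega),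
        d_eq_zero M.cx (i + n + 1) (j + n + 1) (by omega),
        tr_of_ne M.cx (show i + n ≠ j + n + 1 by omega)])
    (by
      intro i j k hj hk x
      ext
      · simp [cylD_apply, d_d_apply, Units.smul_def]
      · simp [cylD_apply, d_d_apply, tr_d M.cx (show j + n = k + n + 1 by omega), Units.smul_def,
          d_tr M.cx (show i + n = j + n + 1 by omega)])
    (cylSMul M n)
    (by intro i h m; ext <;> simp [cylSMul_apply, M.one_smul])
    (by
      intro i j k ij jk l hij hjk h h' a b m
      have e1 := M.mul_smul (k := k + n) (jk := jk + n) (l := l + n) hij (by omega) (by omega)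
        (by omega) a b m.1
      have e2 := M.mul_smul (k := k + n + 1) (jk := jk + n + 1) (l := l + n + 1) hij (by omega)
        (by omega) (by omega) a b m.2
      have s1 : (n * ij).negOnePow = (n * i).negOnePow * (n * j).negOnePow := by
        rw [← Int.negOnePow_add, ← hij]; congr 1; ring
      have s2 : ((n + 1) * ij).negOnePow = ((n + 1) * i).negOnePow * ((n + 1) * j).negOnePow := by
        rw [← Int.negOnePow_add, ← hij]; congr 1; ring
      ext
      · simp only [cylSMul_apply, e1, s1, Units.smul_def, map_zsmul, Units.val_mul, smul_smul]
      · simp only [cylSMul_apply, e2, s2, Units.smul_def, map_zsmul, Units.val_mul, smul_smul])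
    (by
      intro i i' j j' k k' hi hj hk h h₁ h₂ a m
      have e1 := M.leibniz (j := j + n) (j' := j' + n) (k := k + n) (k' := k' + n) hi
        (by omega) (by omega) (by omega) (by omega) (by omega) a m.1
      have e2 := M.leibniz (j := j + n + 1) (j' := j' + n + 1) (k := k + n + 1)
        (k' := k' + n + 1) hi (by omega) (by omega) (by omega) (by omega) (by omega) a m.2
      have e3 := smul_tr M (i := i) (j := j + n) (k := k + n) (j' := j' + n + 1)
        (k' := k' + n + 1) (by omega) (by omega) (by omega) a m.1
      have s1 : (n * i).negOnePow = (n * i').negOnePow * n.negOnePow := by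
        rw [← Int.negOnePow_add, ← hi]; congr 1; ring
      have s2 : ((n + 1) * i).negOnePow = (n * i').negOnePow * n.negOnePow * i.negOnePow := by
        rw [← Int.negOnePow_add, ← Int.negOnePow_add, ← hi]; congr 1; ring
      have s3 : ((n + 1) * i').negOnePow = -((n * i').negOnePow * i.negOnePow) := by
        rw [← hi, Int.negOnePow_succ, mul_neg, neg_neg, ← Int.negOnePow_add]; congr 1; ring
      -- Every sign is now a product of three units `±1`, so eight cases remain, each an identity in
      -- an abelian group.
      obtain h1 | h1 := Int.units_eq_one_or (n * i').negOnePow <;>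
      obtain h2 | h2 := Int.units_eq_one_or n.negOnePow <;>
      obtain h3 | h3 := Int.units_eq_one_or i.negOnePow <;>
      refine Prod.ext ?_ ?_ <;>
      simp [cylD_apply, cylSMul_apply, e1, e2, e3, s1, s2, s3, h1, h2, h3] <;> abel)

variable {M}

variable {N : DGModule A}

/-- The components of a morphism from `cyl M n`, as maps on pairs. -/
def cylApp {n : ℤ} (f : cyl M n ⟶ N) (k : ℤ) :
    (M.cx.X (k + n) × M.cx.X (k + n + 1)) →ₗ[R] N.cx.X k := Hom.app f k

theorem cyl_hom_ext {n : ℤ} {f g : cyl M n ⟶ N} (h : ∀ k x, cylApp f k x = cylApp g k x) : f = g :=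
  hom_ext' h

theorem cylApp_d {n : ℤ} (f : cyl M n ⟶ N) (i j : ℤ) (x : M.cx.X (i + n) × M.cx.X (i + n + 1)) :
    cylApp f j (cylD M n i j x) = (N.cx.d i j).hom (cylApp f i x) :=
  app_d f i j x

theorem cylApp_smul {n : ℤ} (f : cyl M n ⟶ N) {i j k : ℤ} (h : i + j = k) (a : A.cx.X i)
    (x : M.cx.X (j + n) × M.cx.X (j + n + 1)) :
    cylApp f k (cylSMul M n h a x) = N.smul h a (cylApp f j x) :=
  app_smul f h a x

/-- The morphism from `cyl M n` given by a homomorphism of degree `-n`. -/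
def cylDesc {n m m' : ℤ} (hm : m + n = 0) (hm' : m' + 1 = m) (φ : homDeg M N m) : cyl M n ⟶ N :=
  mkHom (M := cyl M n)
    -- The value on generators is free; commuting with the differentials forces the value on formal
    -- differentials to be `∂φ`.
    (fun k => φ.1 (k + n) k ∘ₗ LinearMap.fst R _ _ +
      (homD M N m m' hm' φ).1 (k + n + 1) k ∘ₗ LinearMap.snd R _ _)
    (by
      intro i j hij (x : M.cx.X (i + n) × M.cx.X (i + n + 1))
      have s1 : m.negOnePow = n.negOnePow := by
        rw [show m = -n by omega, Int.negOnePow_neg]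
      have s2 : m'.negOnePow = -n.negOnePow := by
        rw [← s1, ← hm', Int.negOnePow_succ, neg_neg]
      have e1 := homDeg_tr (homD M N m m' hm' φ) (show i + n = j + n + 1 by omega) j x.1
      have e2 := homD_apply hm' φ (i' := j + n) (j := i) (j' := j) (by omega) hij x.1
      have e3 := homD_apply (n' := m' - 1) (by omega) (homD M N m m' hm' φ) (i' := j + n + 1)
        (j := i) (j' := j) (by omega) hij x.2
      -- On the second summand, commuting with the differentials amounts to `∂(∂φ) = 0`.
      rw [homD_homD] at e3
      have e4 := sub_eq_zero.1 e3.symm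
      change φ.1 (j + n) j (cylD M n i j x).1 +
        (homD M N m m' hm' φ).1 (j + n + 1) j (cylD M n i j x).2 =
        (N.cx.d i j).hom (φ.1 (i + n) i x.1 + (homD M N m m' hm' φ).1 (i + n + 1) i x.2)
      rw [cylD_apply, map_add, e4, map_sub, e1, e2, s1, s2]
      simp only [Units.smul_def, map_zsmul, Units.val_neg, neg_smul]
      abel)
    (by
      intro i j k h a (x : M.cx.X (j + n) × M.cx.X (j + n + 1))
      have s1 : (m * i).negOnePow = (n * i).negOnePow := by
        rw [show m * i = -(n * i) by rw [show m = -n by omega]; ring, Int.negOnePow_neg]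
      have s2 : (m' * i).negOnePow = ((n + 1) * i).negOnePow := by
        rw [show m' * i = -((n + 1) * i) by rw [show m' = -(n + 1) by omega]; ring,
          Int.negOnePow_neg]
      have e1 := φ.2.2 (show i + (j + n) = k + n by omega) h a x.1
      have e2 := (homD M N m m' hm' φ).2.2 (show i + (j + n + 1) = k + n + 1 by omega) h a x.2
      change φ.1 (k + n) k (cylSMul M n h a x).1 +
        (homD M N m m' hm' φ).1 (k + n + 1) k (cylSMul M n h a x).2 =
        N.smul h a (φ.1 (j + n) j x.1 + (homD M N m m' hm' φ).1 (j + n + 1) j x.2)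
      rw [cylSMul_apply]
      simp only [Units.smul_def, map_zsmul, e1, e2, s1, s2, smul_smul, map_add,
        Int.units_coe_mul_self, one_zsmul])

theorem cylApp_cylDesc {n m m' : ℤ} (hm : m + n = 0) (hm' : m' + 1 = m) (φ : homDeg M N m) (k : ℤ)
    (x : M.cx.X (k + n) × M.cx.X (k + n + 1)) : cylApp (cylDesc hm hm' φ) k x =
      φ.1 (k + n) k x.1 + (homD M N m m' hm' φ).1 (k + n + 1) k x.2 := rfl

/-- The homomorphism of degree `-n` given by a morphism from `cyl M n`. -/
def cylRestrict {n m : ℤ} (hm : m + n = 0) (f : cyl M n ⟶ N) : homDeg M N m :=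
  ⟨fun i j => cylApp f j ∘ₗ LinearMap.inl R (M.cx.X (j + n)) (M.cx.X (j + n + 1)) ∘ₗ
      tr M.cx i (j + n), by
    intro i j h
    ext x
    have : tr M.cx i (j + n) x = 0 := tr_of_ne M.cx (by omega) x
    simp only [LinearMap.comp_apply, this, map_zero, LinearMap.zero_apply], by
    intro i j k j' k' h h' a x
    simp only [LinearMap.comp_apply]
    obtain hj | hj := em (j = j' + n)
    · have s1 : (m * i).negOnePow = (n * i).negOnePow := by
        rw [show m * i = -(n * i) by rw [show m = -n by omega]; ring, Int.negOnePow_neg]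
      rw [← cylApp_smul, cylSMul_apply, s1,
        smul_tr M h (show i + (j' + n) = k' + n by omega) hj, Units.smul_def, ← map_zsmul]
      congr 1
      simp [Units.smul_def, smul_smul]
    · rw [tr_of_ne M.cx hj, tr_of_ne M.cx (show k ≠ k' + n by omega)]
      simp only [map_zero, smul_zero]⟩

theorem cylRestrict_apply {n m : ℤ} (hm : m + n = 0) (f : cyl M n ⟶ N) (i j : ℤ)
    (x : M.cx.X i) : (cylRestrict hm f).1 i j x =
      cylApp f j (tr M.cx i (j + n) x, 0) := rfl

/-- Morphisms from `cyl M n` are homomorphisms of degree `-n`. -/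
def cylEquiv {n m m' : ℤ} (hm : m + n = 0) (hm' : m' + 1 = m) :
    (cyl M n ⟶ N) ≃+ homDeg M N m where
  toFun := cylRestrict hm
  invFun := cylDesc hm hm'
  left_inv f := by
    have s1 : m.negOnePow = n.negOnePow := by
      rw [show m = -n by omega, Int.negOnePow_neg]
    apply cyl_hom_ext
    intro k x
    -- A morphism is determined by its first component, since `(0, y) = d(y, 0) - (-1)^n (dy, 0)`.
    rw [cylApp_cylDesc, cylRestrict_apply, homD_apply hm' _ (i' := k + n) (j := k + 1) rfl rfl,
      cylRestrict_apply, cylRestrict_apply, ← cylApp_d, cylD_apply, tr_self,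
      LinearMap.id_apply, LinearMap.id_apply,
      Units.smul_def m.negOnePow, ← map_zsmul (cylApp f k), ← map_sub, ← map_add]
    congr 1
    refine Prod.ext ?_ ?_ <;>
    simp [s1, Units.smul_def, d_tr M.cx (show k + n + 1 = k + 1 + n by omega),
      tr_tr M.cx (show k + n + 1 = k + 1 + n by omega) (show k + 1 + n = k + n + 1 by omega)]
  right_inv φ := by
    apply homDeg_ext
    intro i j hij x
    rw [cylRestrict_apply, cylApp_cylDesc, homDeg_tr φ (by omega), map_zero, add_zero]
  map_add' f g := rfl

theorem cyl_projective (hM : IsGradedProjective M) (n : ℤ) : Projective (cyl M n) where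
  factors {N N'} f e he := by
    -- Under `cylEquiv` the lifting problem takes place in degree `-n` of `Hom_A(M, -)`, where
    -- graded-projectivity solves it.
    obtain ⟨φ, hφ⟩ := hM e (fun i => surjective_of_epi e i) (-n)
      (cylRestrict (neg_add_cancel n) f)
    refine ⟨(cylEquiv (m' := -n - 1) (neg_add_cancel n) (by omega)).symm φ, ?_⟩
    apply (cylEquiv (m' := -n - 1) (neg_add_cancel n) (by omega)).injective
    refine Eq.trans ?_ hφ
    apply homDeg_ext
    intro i j hij x
    have := (cylEquiv (m' := -n - 1) (neg_add_cancel n) (by omega)).apply_symm_apply φ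
    exact congrArg (fun ψ : homDeg M N (-n) => Hom.app e j (ψ.1 i j x)) this

variable (M) in
/-- The morphism `cyl M (n + 1) ⟶ cyl M n` inducing the differential of the complex of
homomorphisms. -/
def cylδ {n n' : ℤ} (hn : n + 1 = n') : cyl M n' ⟶ cyl M n :=
  mkHom (M := cyl M n') (N := cyl M n)
    (fun k => LinearMap.inr R (M.cx.X (k + n)) (M.cx.X (k + n + 1)) ∘ₗ
      tr M.cx (k + n') (k + n + 1) ∘ₗ LinearMap.fst R (M.cx.X (k + n')) (M.cx.X (k + n' + 1)))
    (by
      intro i j hij (x : M.cx.X (i + n') × M.cx.X (i + n' + 1))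
      subst hn
      change ((0, tr M.cx _ _ (cylD M (n + 1) i j x).1) :
          M.cx.X (j + n) × M.cx.X (j + n + 1)) =
        cylD M n i j (0, tr M.cx (i + (n + 1)) (i + n + 1) x.1)
      refine Prod.ext ?_ ?_ <;>
      simp [cylD_apply, tr_d M.cx (show j + (n + 1) = j + n + 1 by omega),
        d_tr M.cx (show i + (n + 1) = i + n + 1 by omega), Int.negOnePow_succ, Units.smul_def])
    (by
      intro i j k h a (x : M.cx.X (j + n') × M.cx.X (j + n' + 1))
      subst hn
      change ((0, tr M.cx _ _ (cylSMul M (n + 1) h a x).1) :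
          M.cx.X (k + n) × M.cx.X (k + n + 1)) =
        cylSMul M n h a (0, tr M.cx (j + (n + 1)) (j + n + 1) x.1)
      rw [cylSMul_apply, cylSMul_apply]
      refine Prod.ext ?_ ?_
      · simp
      · simp only [Units.smul_def, map_zsmul]
        rw [smul_tr M _ (show i + (j + n + 1) = k + n + 1 by omega) (by omega)])

theorem cylδ_app {n n' : ℤ} (hn : n + 1 = n') (k : ℤ)
    (x : M.cx.X (k + n') × M.cx.X (k + n' + 1)) : Hom.app (cylδ M hn) k x =
      ((0, tr M.cx (k + n') (k + n + 1) x.1) : M.cx.X (k + n) × M.cx.X (k + n + 1)) := rfl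

theorem cylApp_cylδ_comp {n n' : ℤ} (hn : n + 1 = n') (f : cyl M n ⟶ N) (k : ℤ)
    (x : M.cx.X (k + n') × M.cx.X (k + n' + 1)) : cylApp (cylδ M hn ≫ f) k x =
      cylApp f k (0, tr M.cx (k + n') (k + n + 1) x.1) := rfl

theorem cylδ_cylδ {n n' n'' : ℤ} (hn : n + 1 = n') (hn' : n' + 1 = n'') :
    cylδ M hn' ≫ cylδ M hn = 0 := by
  apply cyl_hom_ext
  intro k x
  rw [cylApp_cylδ_comp]
  refine (cylδ_app hn k _).trans ?_
  rw [map_zero]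
  rfl

/-- Kernel and image are both the second summand: `cylδ` is `(x, y) ↦ (0, x)` up to relabelling
degrees. -/
theorem cylδ_exact {n n' n'' : ℤ} (hn : n + 1 = n') (hn' : n' + 1 = n'') (k : ℤ)
    (x : (cyl M n').cx.X k) (hx : Hom.app (cylδ M hn) k x = 0) :
    ∃ y, Hom.app (cylδ M hn') k y = x := by
  subst hn hn'
  change M.cx.X _ × M.cx.X _ at x
  have h1 : tr M.cx (k + (n + 1)) (k + n + 1) x.1 = 0 := congrArg Prod.snd hx
  have h2 : x.1 = 0 := by
    rw [← LinearMap.id_apply (R := R) x.1, ← tr_self,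
      ← tr_tr M.cx (show k + (n + 1) = k + n + 1 by omega)
      (show k + n + 1 = k + (n + 1) by omega), h1, map_zero]
  refine ⟨((tr M.cx (k + (n + 1) + 1) (k + (n + 1 + 1)) x.2, 0) : M.cx.X _ × M.cx.X _), ?_⟩
  rw [cylδ_app]
  refine Prod.ext h2.symm ?_
  rw [tr_tr M.cx (by omega) (by omega), tr_self]
  rfl

/-- `cylδ` moves generators to formal differentials, where the morphism attached to `φ` takes the
value `∂φ`. The signs built into `cyl` leave none here, so the complex of morphisms is `Hom_A(M, N)`
on the nose. -/
theorem cylRestrict_cylδ {n n' m m' : ℤ} (hn : n + 1 = n') (hm : m + n = 0) (hm' : m' + n' = 0)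
    (h : m' + 1 = m) (f : cyl M n ⟶ N) :
    cylRestrict hm' (cylδ M hn ≫ f) = homD M N m m' h (cylRestrict hm f) := by
  obtain ⟨φ, rfl⟩ := (cylEquiv hm h).symm.surjective f
  have h2 : cylRestrict hm ((cylEquiv hm h).symm φ) = φ := (cylEquiv hm h).apply_symm_apply φ
  rw [h2]
  apply homDeg_ext
  intro i j hij x
  rw [cylRestrict_apply, cylApp_cylδ_comp]
  refine (cylApp_cylDesc hm h φ j _).trans ?_
  rw [map_zero, zero_add, homDeg_tr _ (by omega), homDeg_tr _ (by omega)]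

variable (M) in
/-- The augmentation of the resolution of `M` by the DG modules `cyl M n`. -/
def cylπ : cyl M 0 ⟶ M := cylDesc (m' := -1) (zero_add 0) rfl (homDegOfHom (𝟙 M))

/-- The identity of `M` is a cycle, so the augmentation vanishes on formal differentials. -/
theorem cylπ_app (k : ℤ) (x : M.cx.X (k + 0) × M.cx.X (k + 0 + 1)) :
    Hom.app (cylπ M) k x = tr M.cx (k + 0) k x.1 := by
  refine (cylApp_cylDesc _ _ _ k x).trans ?_
  rw [homD_homDegOfHom]
  exact add_zero _

theorem cylπ_surjective (k : ℤ) : Function.Surjective (Hom.app (cylπ M) k) := fun x =>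
  ⟨((tr M.cx k (k + 0) x, 0) : M.cx.X _ × M.cx.X _), by
    rw [cylπ_app, tr_tr M.cx (by omega) (by omega), tr_self]; rfl⟩

theorem cylδ_cylπ : cylδ M (zero_add 1) ≫ cylπ M = 0 := by
  apply cyl_hom_ext
  intro k x
  rw [cylApp_cylδ_comp]
  refine (cylπ_app k _).trans ?_
  rw [map_zero]
  rfl

theorem cylπ_exact (k : ℤ) (x : (cyl M 0).cx.X k) (hx : Hom.app (cylπ M) k x = 0) :
    ∃ y, Hom.app (cylδ M (zero_add 1)) k y = x := by
  change M.cx.X _ × M.cx.X _ at x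
  rw [cylπ_app] at hx
  have h2 : x.1 = 0 := by
    rw [← LinearMap.id_apply (R := R) x.1, ← tr_self, ← tr_tr M.cx (show k + 0 = k by omega)
      (show k = k + 0 by omega), hx, map_zero]
  refine ⟨((tr M.cx (k + 0 + 1) (k + 1) x.2, 0) : M.cx.X _ × M.cx.X _), ?_⟩
  rw [cylδ_app]
  refine Prod.ext h2.symm ?_
  rw [tr_tr M.cx (by omega) (by omega), tr_self]
  rfl

end Cylinder

/-! ### The projective resolution by the modules `cyl M n` -/

theorem exact_of_forall (S : ShortComplex (DGModule A))
    (h : ∀ i x, Hom.app S.g i x = 0 → ∃ y, Hom.app S.f i y = x) : S.Exact := by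
  rw [S.exact_iff_epi_kernel_lift]
  apply epi_of_surjective
  intro i x
  have hx : Hom.app S.g i (Hom.app (kernel.ι S.g) i x) = 0 := by
    rw [← comp_app, kernel.condition]; rfl
  obtain ⟨y, hy⟩ := h i _ hx
  refine ⟨y, injective_of_mono (kernel.ι S.g) i ?_⟩
  rw [← hy, ← comp_app, kernel.lift_ι]

section Resolution

variable (M : DGModule A)

/-- The complex of the DG modules `cyl M n`. -/
noncomputable def cylComplex : ChainComplex (DGModule A) ℕ :=
  ChainComplex.of (fun n : ℕ => cyl M n) (fun n => cylδ M (by push_cast; rfl))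
    (fun _ => cylδ_cylδ _ _)

theorem cylComplex_d (n : ℕ) :
    (cylComplex M).d (n + 1) n =
      cylδ M (n := (n : ℤ)) (n' := ((n + 1 : ℕ) : ℤ)) (by push_cast; rfl) :=
  ChainComplex.of_d (fun n : ℕ => cyl M n) (fun n => cylδ M (by push_cast; rfl)) n

theorem cylComplex_exactAt_succ (n : ℕ) : (cylComplex M).ExactAt (n + 1) := by
  rw [HomologicalComplex.exactAt_iff' _ (n + 1 + 1) (n + 1) n (by simp) (by simp)]
  apply exact_of_forall
  intro i x hx
  change Hom.app ((cylComplex M).d (n + 1) n) i x = 0 at hx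
  change ∃ y, Hom.app ((cylComplex M).d (n + 1 + 1) (n + 1)) i y = x
  rw [cylComplex_d] at hx ⊢
  exact cylδ_exact _ _ i x hx

/-- The augmentation of `cylComplex M`, as a chain map. -/
noncomputable def cylComplexπ : cylComplex M ⟶ (ChainComplex.single₀ (DGModule A)).obj M :=
  (ChainComplex.toSingle₀Equiv _ _).symm ⟨(cylπ M : (cylComplex M).X 0 ⟶ M), by
    rw [cylComplex_d]; exact cylδ_cylπ⟩

theorem cylComplexπ_f_zero : (cylComplexπ M).f 0 = cylπ M :=
  ChainComplex.toSingle₀Equiv_symm_apply_f_zero _ _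

/-- The resolution of a graded-projective DG module by the DG modules `cyl M n`. -/
noncomputable def cylResolution (hM : IsGradedProjective M) : ProjectiveResolution M where
  complex := cylComplex M
  projective n := cyl_projective hM n
  π := cylComplexπ M
  quasiIso := ⟨fun n => by
    cases n
    -- In degree zero the condition is exactness at `cyl M 0` and surjectivity of the augmentation.
    · rw [ChainComplex.quasiIsoAt₀_iff, ShortComplex.quasiIso_iff_of_zeros']
      · constructor
        · apply exact_of_forall
          intro i x hx
          change Hom.app ((cylComplexπ M).f 0) i x = 0 at hx
          rw [cylComplexπ_f_zero] at hx
          change ∃ y, Hom.app ((cylComplex M).d (0 + 1) 0) i y = x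
          rw [cylComplex_d]
          exact cylπ_exact i x hx
        · change Epi ((cylComplexπ M).f 0)
          rw [cylComplexπ_f_zero]
          exact epi_of_surjective (cylπ M) cylπ_surjective
      · exact (cylComplex M).shape _ _ (by simp)
      · rfl
      · rfl
    · rw [quasiIsoAt_iff_exactAt']
      · apply cylComplex_exactAt_succ
      · apply ChainComplex.exactAt_succ_single_obj⟩

end Resolution

/-! ### Comparison of the two Ext groups -/

/-- For a graded-projective DG module `Q`, the Yoneda Ext groups in positive degrees are computed
by the complex of homomorphisms. -/
theorem nonempty_YExt_addEquiv (Q N : DGModule A) (hQ : IsGradedProjective Q) (n : ℕ) :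
    Nonempty (YExt (n + 1) Q N ≃+ (homComplex Q N).homology (-((n + 1 : ℕ) : ℤ))) := by
  let K := (cylResolution Q hQ).complex.linearYonedaObj ℤ N
  let L := homComplex Q N
  -- As the degree is `n + 1`, there is a genuine incoming term in degree `n`, matching `Hom_A(Q,
  -- N)` in degree `-n`.
  let e₁ := ((cylResolution Q hQ).isoExt (R := ℤ) (n + 1) N ≪≫
    ShortComplex.homologyMapIso (K.isoSc' n (n + 1) (n + 1 + 1) (by simp) (by simp))
    ).toLinearEquiv.toAddEquiv
  let e₃ := (ShortComplex.homologyMapIso (L.isoSc' (-(n : ℤ)) (-((n + 1 : ℕ) : ℤ))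
    (-((n + 1 + 1 : ℕ) : ℤ)) (by simp) (by simp; ring))).toLinearEquiv.toAddEquiv
  -- `cylEquiv` is a map of complexes by `cylRestrict_cylδ`. The auxiliary degree `m'` enters only
  -- its inverse.
  have hd (k : ℕ) (f : cyl Q k ⟶ N) : cylEquiv (m' := -((k + 1 : ℕ) : ℤ) - 1)
      (neg_add_cancel ((k + 1 : ℕ) : ℤ)) (by omega) ((K.d k (k + 1)).hom f) =
        (L.d (-(k : ℤ)) (-((k + 1 : ℕ) : ℤ))).hom
        (cylEquiv (m' := -(k : ℤ) - 1) (neg_add_cancel (k : ℤ)) (by omega) f) := by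
    refine Eq.trans ?_ (homComplex_d_apply (by push_cast; ring) _).symm
    refine Eq.trans ?_ (cylRestrict_cylδ (n := (k : ℤ)) (n' := ((k + 1 : ℕ) : ℤ))
      (by push_cast; rfl) (neg_add_cancel (k : ℤ)) (neg_add_cancel ((k + 1 : ℕ) : ℤ)) _ f)
    rw [← cylComplex_d]
    rfl
  -- One side consists of `ℤ`-modules and the other of `R`-modules, so the homologies are compared
  -- additively.
  obtain ⟨e₂⟩ := ShortComplex.nonempty_homology_addEquiv
    (K.sc' n (n + 1) (n + 1 + 1)) (L.sc' (-(n : ℤ)) (-((n + 1 : ℕ) : ℤ))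
    (-((n + 1 + 1 : ℕ) : ℤ)))
    (cylEquiv (m' := -(n : ℤ) - 1) (neg_add_cancel (n : ℤ)) (by omega))
    (cylEquiv (m' := -((n + 1 : ℕ) : ℤ) - 1) (neg_add_cancel ((n + 1 : ℕ) : ℤ)) (by omega))
    (cylEquiv (m' := -((n + 1 + 1 : ℕ) : ℤ) - 1) (neg_add_cancel ((n + 1 + 1 : ℕ) : ℤ)) (by omega))
    (fun f => hd n f) (fun f => hd (n + 1) f)
  exact ⟨e₁.trans (e₂.trans e₃.symm)⟩

end DGModule

theorem theoremA {R : Type u} [CommRing R] (A : DGAlgebra R) (Q N : DGModule A)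
    (hQ : DGModule.IsSemiProjective Q) (P : DGModule.SemiProjectiveResolution Q)
    (i : ℕ) (hi : 1 ≤ i) :
    Nonempty (DGModule.YExt i Q N ≃+ P.DGExt i N) := by
  obtain ⟨n, rfl⟩ : ∃ n, i = n + 1 := ⟨i - 1, by omega⟩
  -- Graded-projectivity of `Q` gives the comparison with `Hom_A(Q, N)`; semi-projectivity of `P`
  -- and `Q` then allows the passage to `Hom_A(P, N)`.
  obtain ⟨e⟩ := DGModule.nonempty_YExt_addEquiv Q N hQ.1 n
  obtain ⟨h⟩ := DGModule.nonempty_homotopyEquiv P.isSemiProjective hQ P.π P.isQuasiIso N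
  exact ⟨e.trans (h.toHomologyIso _).toLinearEquiv.toAddEquiv⟩
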